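/- Let $n\ge 1$. Let $K\subset\mathbb R^n$ denote an origin-symmetric convex body (compact, convex, with non-empty interior, $-K=K$), with volume $|K|$ and Minkowski functional $\|x\|_K=\inf\{\lambda\ge 0: x\in\lambda K\}$. For $1\le p<\infty$ put $$\|z\|_{Z_p^*K}^p=\frac{n+p}{2}\int_K|z\cdot y|^p\,dy\quad(z\in\mathbb R^n),$$ and, for $g$ on $\mathbb R^n\times\mathbb R^n$, $$[g]_{M^p}^p=\sup_{\lambda>0}\lambda^p\,\mathcal L^{2n}\big(\{(x,y)\in\mathbb R^n\times\mathbb R^n:\ |g(x,y)|\ge\lambda\}\big),$$ where $\mathcal L^{2n}$ is Lebesgue measure on $\mathbb R^n\times\mathbb R^n$. Functions $f$ are real-valued. (a) There is a constant $C=C(n)>0$, depending only on $n$, such that for all $1\le p<\infty$, all origin-symmetric convex bodies $K\subset\mathbb R^n$ and all $f\in C_c^\infty(\mathbb R^n)$, $$\frac2n\int_{\mathbb R^n}\|\nabla f(x)\|_{Z_p^*K}^p\,dx\ \le\ \left[\frac{f(x)-f(y)}{\|x-y\|_K^{\frac np+1}}\right]_{M^p}^p\ \le\ C\int_{\mathbb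 R^n}\|\nabla f(x)\|_{Z_p^*K}^p\,dx.$$ Moreover, with $E_{\lambda,K}=\Big\{(x,y)\in\mathbb R^n\times\mathbb R^n:\ x\ne y,\ \frac{|f(x)-f(y)|}{\|x-y\|_K^{n/p+1}}\ge\lambda\Big\}$, $$\lim_{\lambda\to\infty}\lambda^p\mathcal L^{2n}(E_{\lambda,K})=\frac2n\int_{\mathbb R^n}\|\nabla f(x)\|_{Z_p^*K}^p\,dx.$$ (b) For all $1\le p<\infty$, all origin-symmetric convex bodies $K\subset\mathbb R^n$ and all $f\in L^p(\mathbb R^n)$, $$2|K|\,\|f\|_{L^p(\mathbb R^n)}^p\ \le\ \left[\frac{f(x)-f(y)}{\|x-y\|_K^{\frac np}}\right]_{M^p}^p\ \le\ 2^{p+1}|K|\,\|f\|_{L^p(\mathbb R^n)}^p.$$ Moreover, with $\widetilde E_{\lambda,K}=\Big\{(x,y)\in\mathbb R^n\times\mathbb R^n:\ x\ne y,\ \frac{|f(x)-f(y)|}{\|x-y\|_K^{n/p}}\ge\lambda\Big\}$, $$\lim_{\lambda\to0^+}\lambda^p\mathcal L^{2n}(\widetilde E_{\lambda,K})=2|K|\,\|f\|_{L^p(\mathbb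 R^n)}^p.$$ -/

import Mathlib

open MeasureTheory Filter Topology
open scoped ENNReal NNReal ContDiff Gradient

noncomputable section

/-- Euclidean space `ℝⁿ`. -/
abbrev Rn (n : ℕ) : Type := EuclideanSpace ℝ (Fin n)

/-- `K ⊆ ℝⁿ` is an origin-symmetric convex body: compact, convex, with nonempty interior, and
`-K = K`. Its norm `‖·‖_K` is the Minkowski functional `gauge K`. -/
structure IsSymmConvexBody {n : ℕ} (K : Set (Rn n)) : Prop where
  isCompact : IsCompact K
  convex : Convex ℝ K
  nonempty_interior : (interior K).Nonempty
  neg_mem : ∀ x ∈ K, -x ∈ K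

/-- `‖z‖_{Z_p^* K} ^ p = (n + p) / 2 * ∫_K |z · y| ^ p dy`, the `p`-th power of the norm of the polar
`L^p` moment body of `K`. -/
def polarMomentNormPow {n : ℕ} (K : Set (Rn n)) (p : ℝ) (z : Rn n) : ℝ≥0∞ :=
  ENNReal.ofReal ((n + p) / 2) * ∫⁻ y in K, ENNReal.ofReal (|inner ℝ z y| ^ p)

/-- `∫ ‖∇f(x)‖_{Z_p^* K} ^ p dx`. -/
def anisotropicEnergy {n : ℕ} (K : Set (Rn n)) (p : ℝ) (f : Rn n → ℝ) : ℝ≥0∞ :=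
  ∫⁻ x, polarMomentNormPow K p (∇ f x)

/-- The `p`-th power `sup_{t > 0} t ^ p * 𝓛²ⁿ {|g| ≥ t}` of the Marcinkiewicz (weak `L^p`)
quasinorm of `g` on `ℝⁿ × ℝⁿ`. -/
def weakLpQuasinormPow {n : ℕ} (p : ℝ) (g : Rn n × Rn n → ℝ) : ℝ≥0∞ :=
  ⨆ (t : ℝ) (_ : 0 < t), ENNReal.ofReal (t ^ p) * volume {z : Rn n × Rn n | t ≤ |g z|}

/-- The function `(x, y) ↦ (f x - f y) / ‖x - y‖_K ^ s`. (On the diagonal, which is a null set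
when `n ≥ 1`, it is given the value `0`.) -/
def anisotropicQuotient {n : ℕ} (K : Set (Rn n)) (s : ℝ) (f : Rn n → ℝ) (z : Rn n × Rn n) : ℝ :=
  (f z.1 - f z.2) / gauge K (z.1 - z.2) ^ s

/-- The set `{(x, y) | x ≠ y, |f x - f y| / ‖x - y‖_K ^ s ≥ t}`. -/
def superlevelSet {n : ℕ} (K : Set (Rn n)) (s : ℝ) (f : Rn n → ℝ) (t : ℝ) : Set (Rn n × Rn n) :=
  {z | z.1 ≠ z.2 ∧ t ≤ |f z.1 - f z.2| / gauge K (z.1 - z.2) ^ s}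

end

/-! Everything rests on scaling in the difference variable `v = y - x`, with `N` the gauge of `K`.

Part (a), limit. Put `τ = t ^ (-p/n)`. Replacing `v` by `τ v` turns `t ^ p` times the measure of the
superlevel set into the measure of the pairs `(x, v)` with `v ≠ 0` and `N(v) ^ (n/p+1) ≤ |(f(x + τ
v) - f(x)) / τ|`. As `t → ∞` these sets converge a.e. to `{N(v) ^ (n/p+1) ≤ |∇f(x) · v|}`, and they
stay in one bounded set because `f` is Lipschitz with compact support. Polar coordinates compute the
measure of the limit set (`volume_gauge_rpow_le_abs_inner`). The lower bound follows, since a limit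
of the rescaled measures is at most their supremum.

Part (a), upper bound, by rotations. Fix a direction `w`. If `(x, x + r w)` lies in the superlevel
set, the fundamental theorem of calculus and Hölder force the segment from `x` to `x + r w` to carry
mass at least `t ^ p N(w) ^ (n+p) r ^ (n+1)` of `|∇f · w| ^ p`. A Vitali selection of disjoint
segments (`lintegral_heavy_intervals_le`) bounds the `r ^ (n-1) dr dx` measure of such heavy
segments by the total mass, with a constant depending on `n` only. Integrating over `w` gives back
the energy.

Part (b). The set `{t N(x - y) ^ (n/p) ≤ |f(x)|}` has measure exactly `t ^ (-p) |K| ∫ |f| ^ p`,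
likewise with `f(y)`. Two such sets at level `t / 2` cover the superlevel set, which is the upper
bound. If `f` vanishes off a set `A` of finite measure, the measure of the superlevel set differs
from the sum of the two at level `t` by at most a multiple of `|A × A|`, negligible after
multiplication by `t ^ p` as `t → 0`. A general `f` is split into its values above a small height
and a remainder small in `L^p`, which the upper bound controls. -/

/-! ### The gauge of a symmetric convex body. -/

namespace IsSymmConvexBody

variable {n : ℕ} {K : Set (Rn n)}

/-- The origin is the midpoint of an interior point `x` and of `-x ∈ K`. -/
lemma mem_nhds_zero (hK : IsSymmConvexBody K) : K ∈ 𝓝 0 := by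
  obtain ⟨x, hx⟩ := hK.nonempty_interior
  have h := hK.convex.combo_interior_self_mem_interior hx (hK.neg_mem x (interior_subset hx))
    (a := 1 / 2) (b := 1 / 2) (by norm_num) (by norm_num) (by norm_num)
  have h0 : (1 / 2 : ℝ) • x + (1 / 2 : ℝ) • (-x) = 0 := by module
  rw [h0] at h
  exact mem_interior_iff_mem_nhds.1 h

lemma continuous_gauge (hK : IsSymmConvexBody K) : Continuous (gauge K) :=
  _root_.continuous_gauge hK.convex hK.mem_nhds_zero

lemma gauge_pos (hK : IsSymmConvexBody K) {v : Rn n} (hv : v ≠ 0) : 0 < gauge K v :=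
  (_root_.gauge_pos (absorbent_nhds_zero hK.mem_nhds_zero)
    (NormedSpace.isVonNBounded_of_isBounded ℝ hK.isCompact.isBounded)).2 hv

lemma gauge_sub_comm (hK : IsSymmConvexBody K) (x y : Rn n) :
    gauge K (x - y) = gauge K (y - x) := by
  rw [← neg_sub, gauge_neg hK.neg_mem]

lemma gauge_smul {a : ℝ} (ha : 0 ≤ a) (v : Rn n) : gauge K (a • v) = a * gauge K v := by
  rw [gauge_smul_of_nonneg ha, smul_eq_mul]

lemma gauge_le_one_iff (hK : IsSymmConvexBody K) {v : Rn n} : gauge K v ≤ 1 ↔ v ∈ K := by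
  rw [gauge_le_one_iff_mem_closure hK.convex hK.mem_nhds_zero, hK.isCompact.isClosed.closure_eq]

lemma exists_norm_le_mul_gauge (hK : IsSymmConvexBody K) :
    ∃ c : ℝ, 0 < c ∧ ∀ v, ‖v‖ ≤ c * gauge K v := by
  obtain ⟨c, hc, h⟩ := hK.isCompact.isBounded.exists_pos_norm_le
  refine ⟨c, hc, fun v => ?_⟩
  rcases eq_or_ne v 0 with rfl | hv
  · simp
  have hg := hK.gauge_pos hv
  have hm : (gauge K v)⁻¹ • v ∈ K := by
    rw [← hK.gauge_le_one_iff, gauge_smul (by positivity), inv_mul_cancel₀ hg.ne']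
  have := h _ hm
  rw [norm_smul, norm_inv, Real.norm_of_nonneg hg.le, inv_mul_le_iff₀ hg] at this
  linarith

open scoped Pointwise in
lemma volume_gauge_le (hK : IsSymmConvexBody K) (hn : 1 ≤ n) {a : ℝ} (ha : 0 ≤ a) :
    volume {v | gauge K v ≤ a} = ENNReal.ofReal (a ^ n) * volume K := by
  have : NeZero n := ⟨by omega⟩
  rcases ha.eq_or_lt with rfl | ha
  · have : {v | gauge K v ≤ 0} = {0} := by
      ext v
      simp only [Set.mem_ofPred_eq, Set.mem_singleton_iff]
      constructor
      · intro h
        by_contra hv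
        exact absurd (hK.gauge_pos hv) (not_lt.2 h)
      · rintro rfl
        simp
    rw [this]
    simp [show n ≠ 0 by omega]
  · have : {v | gauge K v ≤ a} = a • K := by
      ext v
      rw [Set.mem_smul_set_iff_inv_smul_mem₀ ha.ne', ← hK.gauge_le_one_iff,
        gauge_smul (by positivity), inv_mul_le_iff₀ ha, mul_one]
      rfl
    rw [this, Measure.addHaar_smul_of_nonneg _ ha.le]
    simp

lemma volume_lt_top (hK : IsSymmConvexBody K) : volume K < ⊤ := hK.isCompact.measure_lt_top

end IsSymmConvexBody

/-! ### Polar coordinates and power integrals. -/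

/-- Integration in polar coordinates. -/
lemma lintegral_eq_lintegral_sphere {E : Type*} [NormedAddCommGroup E] [NormedSpace ℝ E]
    [MeasurableSpace E] [BorelSpace E] [FiniteDimensional ℝ E] [Nontrivial E]
    (μ : Measure E) [μ.IsAddHaarMeasure] {g : E → ℝ≥0∞} (hg : Measurable g) :
    ∫⁻ v, g v ∂μ = ∫⁻ w : Metric.sphere (0 : E) 1, ∫⁻ r in Set.Ioi (0 : ℝ),
      ENNReal.ofReal (r ^ (Module.finrank ℝ E - 1)) * g (r • (w : E)) ∂volume ∂μ.toSphere := by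
  have hmeas : Measurable fun z : Metric.sphere (0 : E) 1 × Set.Ioi (0 : ℝ) =>
      g ((z.2 : ℝ) • (z.1 : E)) := by
    apply hg.comp
    fun_prop
  calc
    ∫⁻ v, g v ∂μ = ∫⁻ v in ({0}ᶜ : Set E), g v ∂μ := by rw [restrict_compl_singleton]
    _ = ∫⁻ x : ({(0)}ᶜ : Set E), g x.1 ∂(μ.comap (↑)) := by
      rw [lintegral_subtype_comap (measurableSet_singleton _).compl]
    _ = ∫⁻ z, g ((z.2 : ℝ) • (z.1 : E))
          ∂μ.toSphere.prod (.volumeIoiPow (Module.finrank ℝ E - 1)) := by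
      rw [← μ.measurePreserving_homeomorphUnitSphereProd.lintegral_comp hmeas]
      refine lintegral_congr fun x => ?_
      have h := congrArg Subtype.val ((homeomorphUnitSphereProd E).symm_apply_apply x)
      rw [homeomorphUnitSphereProd_symm_apply_coe] at h
      rw [h]
    _ = _ := by
      rw [lintegral_prod _ hmeas.aemeasurable]
      refine lintegral_congr fun w => ?_
      have hw : Measurable fun r : ℝ => g (r • (w : E)) := hg.comp (by fun_prop)
      rw [Measure.volumeIoiPow, lintegral_withDensity_eq_lintegral_mul]
      · exact lintegral_subtype_comap measurableSet_Ioi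
          (f := fun r : ℝ => ENNReal.ofReal (r ^ (Module.finrank ℝ E - 1)) * g (r • (w : E)))
      · fun_prop
      · exact hw.comp measurable_subtype_coe

lemma setLIntegral_Ioc_rpow {a b : ℝ} (ha : -1 < a) (hb : 0 ≤ b) :
    ∫⁻ r in Set.Ioc 0 b, ENNReal.ofReal (r ^ a) = ENNReal.ofReal (b ^ (a + 1) / (a + 1)) := by
  rw [← ofReal_integral_eq_lintegral_ofReal
    (intervalIntegral.intervalIntegrable_rpow' ha).1, ← intervalIntegral.integral_of_le hb,
    integral_rpow (Or.inl ha), Real.zero_rpow (by linarith), sub_zero]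
  filter_upwards [ae_restrict_mem measurableSet_Ioc] with y hy
  exact Real.rpow_nonneg hy.1.le _

/-! ### Vitali covering on the line and along parallel lines. -/

/-- A Vitali covering estimate: the pairs `(t, r)` such that the mass of `u` on `[t, t + r]` is at
least `c * r ^ (m + 1)` have small total weight with respect to `r ^ (m - 1) dr dt`. -/
lemma lintegral_heavy_intervals_le {m : ℕ} (hm : 1 ≤ m) (u : ℝ → ℝ≥0∞) (c : ℝ≥0∞) (R : ℝ) :
    c * ∫⁻ t, ∫⁻ r, {z : ℝ × ℝ | (0 < z.2 ∧ z.2 ≤ R) ∧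
        c * ENNReal.ofReal (z.2 ^ (m + 1)) ≤ ∫⁻ s in Set.Icc z.1 (z.1 + z.2), u s}.indicator
          (fun z => ENNReal.ofReal (z.2 ^ (m - 1))) (t, r)
      ≤ ENNReal.ofReal (5 ^ (m + 1)) * ∫⁻ s, u s := by
  set A := {z : ℝ × ℝ | (0 < z.2 ∧ z.2 ≤ R) ∧
        c * ENNReal.ofReal (z.2 ^ (m + 1)) ≤ ∫⁻ s in Set.Icc z.1 (z.1 + z.2), u s} with hA
  -- The interval `[t, t + r]` is viewed as the ball of centre `t + r / 2` and radius `r / 2`; the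
  -- cutoff `r ≤ R` supplies the bounded radii that Vitali requires.
  obtain ⟨J, hJA, hJd, hJ⟩ := Vitali.exists_disjoint_subfamily_covering_enlargement_closedBall
    A (fun z => z.1 + z.2 / 2) (fun z => z.2 / 2) (R / 2)
    (fun z hz => by have := hz.1.2; linarith) 5 (by norm_num)
  have hball : ∀ z : ℝ × ℝ, Metric.closedBall (z.1 + z.2 / 2) (z.2 / 2)
      = Set.Icc z.1 (z.1 + z.2) := fun z => by
    rw [Real.closedBall_eq_Icc]; congr 1 <;> ring
  simp only [hball] at hJd hJ
  have hJc : J.Countable := hJd.countable_of_nonempty_interior fun z hz => by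
    rw [interior_Icc]
    exact Set.nonempty_Ioo.2 (by have := (hJA hz).1.1; linarith)
  have := hJc.to_subtype
  -- The fivefold enlargement of the selected interval `[t', t' + r']` is `[t' - 2r', t' + 3r']`. An
  -- interval `[t, t + r]` inside it has `t` in it and `r ≤ 5r'`, so `A` is covered by product sets
  -- whose weighted measures are explicit.
  set a : J → ℝ → ℝ≥0∞ := fun j =>
    (Set.Icc (j.1.1 - 2 * j.1.2) (j.1.1 + 3 * j.1.2)).indicator 1 with ha
  set b : J → ℝ → ℝ≥0∞ := fun j =>
    (Set.Ioc 0 (5 * j.1.2)).indicator fun r => ENNReal.ofReal (r ^ (m - 1)) with hb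
  have ham : ∀ j, Measurable (a j) := fun j => measurable_one.indicator measurableSet_Icc
  have hbm : ∀ j, Measurable (b j) := fun j => Measurable.indicator (by fun_prop) measurableSet_Ioc
  have hpt : ∀ t r, A.indicator (fun z => ENNReal.ofReal (z.2 ^ (m - 1))) (t, r)
      ≤ ∑' j : J, a j t * b j r := by
    intro t r
    by_cases h : (t, r) ∈ A
    · obtain ⟨j, hj, hsub⟩ := hJ _ h
      have hr : 0 < r := h.1.1
      rw [Real.closedBall_eq_Icc, Set.Icc_subset_Icc_iff (by simpa using hr.le)] at hsub
      obtain ⟨h1, h2⟩ := hsub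
      simp only at h1 h2
      refine le_trans ?_ (ENNReal.le_tsum (⟨j, hj⟩ : J))
      have hat : a ⟨j, hj⟩ t = 1 := by
        rw [ha]
        exact Set.indicator_of_mem (Set.mem_Icc.2 ⟨by simp only; linarith, by simp only; linarith⟩) _
      have hbr : b ⟨j, hj⟩ r = ENNReal.ofReal (r ^ (m - 1)) := by
        rw [hb]
        exact Set.indicator_of_mem (Set.mem_Ioc.2 ⟨hr, by simp only; linarith⟩) _
      rw [hat, hbr, one_mul, Set.indicator_of_mem h]
    · rw [Set.indicator_of_notMem h]
      exact zero_le
  have hb_int : ∀ j : J, ∫⁻ r, b j r = ENNReal.ofReal ((5 * j.1.2) ^ m / m) := by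
    intro j
    have h0 : 0 < j.1.2 := (hJA j.2).1.1
    rw [hb, lintegral_indicator measurableSet_Ioc]
    have := setLIntegral_Ioc_rpow (a := ((m - 1 : ℕ) : ℝ)) (b := 5 * j.1.2)
      (by have : (0 : ℝ) ≤ ((m - 1 : ℕ) : ℝ) := by positivity
          linarith) (by positivity)
    simp only [Real.rpow_natCast] at this
    rw [this]
    have h1 : ((m - 1 : ℕ) : ℝ) + 1 = (m : ℝ) := by exact_mod_cast Nat.sub_add_cancel hm
    rw [h1, Real.rpow_natCast]
  have ha_int : ∀ j : J, ∫⁻ t, a j t = ENNReal.ofReal (5 * j.1.2) := by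
    intro j
    rw [ha, lintegral_indicator_one measurableSet_Icc, Real.volume_Icc]
    congr 1; ring
  calc
    _ ≤ c * ∫⁻ t, ∫⁻ r, ∑' j : J, a j t * b j r := by
      gcongr with t r
      exact hpt t r
    _ = c * ∑' j : J, ENNReal.ofReal (5 * j.1.2) * ENNReal.ofReal ((5 * j.1.2) ^ m / m) := by
      congr 1
      have : ∀ t, ∫⁻ r, ∑' j : J, a j t * b j r = ∑' j : J, a j t * ∫⁻ r, b j r := fun t => by
        rw [lintegral_tsum fun j => ((hbm j).const_mul _).aemeasurable]
        exact tsum_congr fun j => lintegral_const_mul _ (hbm j)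
      simp only [this]
      rw [lintegral_tsum fun j => ((ham j).mul_const _).aemeasurable]
      refine tsum_congr fun j => ?_
      rw [lintegral_mul_const _ (ham j), ha_int, hb_int]
    _ = ∑' j : J, c * (ENNReal.ofReal (5 * j.1.2) * ENNReal.ofReal ((5 * j.1.2) ^ m / m)) :=
      ENNReal.tsum_mul_left.symm
    _ ≤ ∑' j : J, ENNReal.ofReal (5 ^ (m + 1)) * ∫⁻ s in Set.Icc j.1.1 (j.1.1 + j.1.2), u s := by
      refine ENNReal.tsum_le_tsum fun j => ?_
      have h0 : 0 < j.1.2 := (hJA j.2).1.1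
      refine le_trans ?_ (mul_le_mul_right (hJA j.2).2 _)
      rw [mul_left_comm _ c]
      refine mul_le_mul_right ?_ c
      rw [← ENNReal.ofReal_mul (by positivity), ← ENNReal.ofReal_mul (by positivity)]
      refine ENNReal.ofReal_le_ofReal ?_
      have h1 : (5 * j.1.2) ^ m / m ≤ (5 * j.1.2) ^ m :=
        div_le_self (by positivity) (by exact_mod_cast hm)
      calc _ ≤ 5 * j.1.2 * (5 * j.1.2) ^ m := by gcongr
        _ = _ := by ring
    _ = ENNReal.ofReal (5 ^ (m + 1)) * ∫⁻ s in ⋃ j ∈ J, Set.Icc j.1 (j.1 + j.2), u s := by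
      rw [ENNReal.tsum_mul_left, lintegral_biUnion hJc (fun _ _ => measurableSet_Icc) hJd]
    _ ≤ _ := by
      gcongr
      exact Measure.restrict_le_self

/-- The estimate of `lintegral_heavy_intervals_le` along the lines of direction `w`. -/
lemma lintegral_heavy_segments_le {E : Type*} [NormedAddCommGroup E] [NormedSpace ℝ E]
    [MeasurableSpace E] [BorelSpace E] [FiniteDimensional ℝ E] (μ : Measure E) [μ.IsAddHaarMeasure]
    {m : ℕ} (hm : 1 ≤ m) {F : E → ℝ≥0∞} (hF : Measurable F) (w : E) (c : ℝ≥0∞) {R : ℝ}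
    (hR : 0 < R) :
    c * ∫⁻ x, ∫⁻ r, {z : E × ℝ | (0 < z.2 ∧ z.2 ≤ R) ∧
        c * ENNReal.ofReal (z.2 ^ (m + 1)) ≤ ∫⁻ s in Set.Icc 0 z.2, F (z.1 + s • w)}.indicator
          (fun z => ENNReal.ofReal (z.2 ^ (m - 1))) (x, r) ∂volume ∂μ
      ≤ 2 * ENNReal.ofReal (5 ^ (m + 1)) * ∫⁻ x, F x ∂μ := by
  set A := {z : E × ℝ | (0 < z.2 ∧ z.2 ≤ R) ∧
        c * ENNReal.ofReal (z.2 ^ (m + 1)) ≤ ∫⁻ s in Set.Icc 0 z.2, F (z.1 + s • w)} with hA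
  have hAm : MeasurableSet A := by
    have h1 : Measurable fun z : E × ℝ => ∫⁻ s in Set.Icc 0 z.2, F (z.1 + s • w) := by
      have h2 : ∀ z : E × ℝ, ∫⁻ s in Set.Icc 0 z.2, F (z.1 + s • w)
          = ∫⁻ s, {q : (E × ℝ) × ℝ | 0 ≤ q.2 ∧ q.2 ≤ q.1.2}.indicator
              (fun q => F (q.1.1 + q.2 • w)) (z, s) := fun z => by
        rw [← lintegral_indicator measurableSet_Icc]
        rfl
      simp only [h2]
      refine Measurable.lintegral_prod_right' (Measurable.indicator (hF.comp (by fun_prop)) ?_)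
      exact (measurableSet_le measurable_const measurable_snd).inter
        (measurableSet_le measurable_snd (measurable_snd.comp measurable_fst))
    exact ((measurableSet_lt measurable_const measurable_snd).inter
      (measurableSet_le measurable_snd measurable_const)).inter
        (measurableSet_le ((measurable_snd.pow_const (m + 1)).ennreal_ofReal.const_mul c) h1)
  set G : E → ℝ≥0∞ := fun x => ∫⁻ r, A.indicator (fun z => ENNReal.ofReal (z.2 ^ (m - 1))) (x, r)
    with hG
  have hGm : Measurable G :=
    Measurable.lintegral_prod_right' (Measurable.indicator (by fun_prop) hAm)
  -- Base points `t ≤ R` and lengths `r ≤ R` only see `F` on `[0, 2R]`. Integrating over `x` and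
  -- using translation invariance then replaces a splitting of the space into lines; the ratio `2R /
  -- R` is the factor `2` in the result.
  have hline : ∀ x, c * ∫⁻ t in Set.Icc 0 R, G (x + t • w)
      ≤ ENNReal.ofReal (5 ^ (m + 1)) * ∫⁻ s in Set.Icc 0 (2 * R), F (x + s • w) := by
    intro x
    have key := lintegral_heavy_intervals_le hm
      ((Set.Icc 0 (2 * R)).indicator fun s => F (x + s • w)) c R
    rw [lintegral_indicator measurableSet_Icc] at key
    refine le_trans ?_ key
    refine mul_le_mul_right ?_ c
    rw [← lintegral_indicator measurableSet_Icc]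
    refine lintegral_mono fun t => ?_
    by_cases ht : t ∈ Set.Icc 0 R
    swap
    · rw [Set.indicator_of_notMem ht]; exact zero_le
    rw [Set.indicator_of_mem ht]
    refine lintegral_mono fun r => ?_
    by_cases hr : (x + t • w, r) ∈ A
    swap
    · rw [Set.indicator_of_notMem hr]; exact zero_le
    rw [Set.indicator_of_mem hr, Set.indicator_of_mem]
    refine ⟨hr.1, hr.2.trans (le_of_eq ?_)⟩
    have hr1 := hr.1.1
    have hr2 := hr.1.2
    simp only at hr1 hr2 ⊢
    have hsub : Set.Icc t (t + r) ⊆ Set.Icc 0 (2 * R) :=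
      Set.Icc_subset_Icc ht.1 (by linarith [ht.2])
    rw [setLIntegral_indicator measurableSet_Icc, Set.inter_eq_right.2 hsub,
      ← lintegral_indicator measurableSet_Icc, ← lintegral_indicator measurableSet_Icc]
    refine Eq.trans ?_ (lintegral_add_left_eq_self
      ((Set.Icc t (t + r)).indicator fun s => F (x + s • w)) t)
    refine lintegral_congr fun s => ?_
    simp only [Set.indicator, Set.mem_Icc]
    have e : (0 ≤ s ∧ s ≤ r) ↔ (t ≤ t + s ∧ t + s ≤ t + r) := by
      constructor <;> rintro ⟨h1, h2⟩ <;> constructor <;> linarith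
    simp only [e, add_smul, add_assoc]
  have hFm : Measurable (Function.uncurry fun (x : E) (s : ℝ) => F (x + s • w)) :=
    hF.comp (by fun_prop)
  have hGm' : Measurable (Function.uncurry fun (x : E) (s : ℝ) => G (x + s • w)) :=
    hGm.comp (by fun_prop)
  have hFi : Measurable fun x => ∫⁻ t in Set.Icc 0 (2 * R), F (x + t • w) :=
    Measurable.lintegral_prod_right' hFm
  have hGi : Measurable fun x => ∫⁻ t in Set.Icc 0 R, G (x + t • w) :=
    Measurable.lintegral_prod_right' hGm'
  have havg : ∀ (H : E → ℝ≥0∞) (T : ℝ),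
      Measurable (Function.uncurry fun (x : E) (s : ℝ) => H (x + s • w)) →
      ∫⁻ x, ∫⁻ t in Set.Icc 0 T, H (x + t • w) ∂volume ∂μ = ENNReal.ofReal T * ∫⁻ x, H x ∂μ := by
    intro H T hH
    rw [lintegral_lintegral_swap hH.aemeasurable]
    simp_rw [lintegral_add_right_eq_self H]
    rw [lintegral_const, Measure.restrict_apply_univ, Real.volume_Icc, sub_zero, mul_comm]
  have hmain : ENNReal.ofReal R * (c * ∫⁻ x, G x ∂μ)
      ≤ ENNReal.ofReal R * (2 * ENNReal.ofReal (5 ^ (m + 1)) * ∫⁻ x, F x ∂μ) := by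
    calc
      _ = ∫⁻ x, c * ∫⁻ t in Set.Icc 0 R, G (x + t • w) ∂volume ∂μ := by
        rw [lintegral_const_mul _ hGi, havg G R hGm']
        ring
      _ ≤ ∫⁻ x, ENNReal.ofReal (5 ^ (m + 1)) * ∫⁻ s in Set.Icc 0 (2 * R),
          F (x + s • w) ∂volume ∂μ :=
        lintegral_mono hline
      _ = _ := by
        rw [lintegral_const_mul _ hFi, havg F _ hFm,
          ENNReal.ofReal_mul (by norm_num)]
        simp only [ENNReal.ofReal_ofNat]
        ring
  exact (ENNReal.mul_le_mul_iff_right (by simpa using hR) ENNReal.ofReal_ne_top).1 hmain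

/-! ### Polar coordinates in Euclidean space. -/

lemma Rn.nontrivial {n : ℕ} (hn : 1 ≤ n) : Nontrivial (Rn n) := by
  have : NeZero n := ⟨by omega⟩
  infer_instance

lemma Rn.lintegral_polar {n : ℕ} (hn : 1 ≤ n) {g : Rn n → ℝ≥0∞} (hg : Measurable g) :
    ∫⁻ v, g v = ∫⁻ w : Metric.sphere (0 : Rn n) 1, ∫⁻ r in Set.Ioi (0 : ℝ),
      ENNReal.ofReal (r ^ (n - 1)) * g (r • (w : Rn n)) ∂volume
        ∂(volume : Measure (Rn n)).toSphere := by
  have := Rn.nontrivial hn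
  rw [lintegral_eq_lintegral_sphere volume hg]
  simp only [finrank_euclideanSpace_fin]

lemma Rn.ne_zero_of_mem_sphere {n : ℕ} (w : Metric.sphere (0 : Rn n) 1) : (w : Rn n) ≠ 0 :=
  ne_zero_of_mem_unit_sphere w

/-- A fibre of the polar coordinate integral: the integral of `r ^ (n - 1 + a)` over `(0, b]`. -/
lemma lintegral_Ioi_pow_mul_indicator {n : ℕ} (hn : 1 ≤ n) {a b : ℝ} (ha : 0 ≤ a) (hb : 0 ≤ b)
    {g : ℝ → ℝ≥0∞}
    (hg : ∀ r, 0 < r → g r = (Set.Iic b).indicator (fun r => ENNReal.ofReal (r ^ a)) r) :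
    ∫⁻ r in Set.Ioi (0 : ℝ), ENNReal.ofReal (r ^ (n - 1)) * g r
      = ENNReal.ofReal (b ^ (n + a) / (n + a)) := by
  have h1 : (((n - 1 : ℕ) : ℝ) + a) + 1 = n + a := by
    rw [Nat.cast_sub hn]; push_cast; ring
  rw [← h1, ← setLIntegral_Ioc_rpow (by have : (0 : ℝ) ≤ ((n - 1 : ℕ) : ℝ) := by positivity
                                        linarith) hb,
    ← lintegral_indicator measurableSet_Ioi, ← lintegral_indicator measurableSet_Ioc]
  refine lintegral_congr fun r => ?_
  by_cases h0 : 0 < r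
  · rw [Set.indicator_of_mem (show r ∈ Set.Ioi (0 : ℝ) from h0), hg r h0]
    by_cases hr : r ≤ b
    · rw [Set.indicator_of_mem (show r ∈ Set.Iic b from hr),
        Set.indicator_of_mem (show r ∈ Set.Ioc 0 b from ⟨h0, hr⟩),
        ← ENNReal.ofReal_mul (by positivity), Real.rpow_add h0, Real.rpow_natCast]
    · rw [Set.indicator_of_notMem (show r ∉ Set.Iic b from hr),
        Set.indicator_of_notMem fun h => hr h.2, mul_zero]
  · rw [Set.indicator_of_notMem (show r ∉ Set.Ioi (0 : ℝ) from h0),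
      Set.indicator_of_notMem fun h => h0 h.1]

/-! ### The polar moment norm as a spherical integral and as a volume. -/

section PolarMoment

variable {n : ℕ} {K : Set (Rn n)} {p : ℝ}

/-- The polar moment body norm as an integral over the sphere. -/
lemma polarMomentNormPow_eq_lintegral_sphere (hn : 1 ≤ n) (hK : IsSymmConvexBody K) (hp : 1 ≤ p)
    (z : Rn n) :
    2 * polarMomentNormPow K p z = ∫⁻ w : Metric.sphere (0 : Rn n) 1,
      ENNReal.ofReal (|inner ℝ z (w : Rn n)| ^ p / gauge K (w : Rn n) ^ (n + p))
        ∂(volume : Measure (Rn n)).toSphere := by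
  have hKm : MeasurableSet K := hK.isCompact.measurableSet
  have hgm : Measurable fun y : Rn n => ENNReal.ofReal (|inner ℝ z y| ^ p) := by fun_prop
  have hnp : (0 : ℝ) < n + p := by positivity
  rw [polarMomentNormPow, ← lintegral_indicator hKm,
    Rn.lintegral_polar hn (hgm.indicator hKm), ← mul_assoc,
    ← lintegral_const_mul' _ _ (ENNReal.mul_ne_top (by simp) ENNReal.ofReal_ne_top)]
  refine lintegral_congr fun w => ?_
  have hN := hK.gauge_pos (Rn.ne_zero_of_mem_sphere w)
  have key : ∀ r : ℝ, 0 < r →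
      K.indicator (fun y => ENNReal.ofReal (|inner ℝ z y| ^ p)) (r • (w : Rn n))
        = ENNReal.ofReal (|inner ℝ z (w : Rn n)| ^ p) *
          (Set.Iic (gauge K (w : Rn n))⁻¹).indicator (fun r => ENNReal.ofReal (r ^ p)) r := by
    intro r hr
    have hmem : r • (w : Rn n) ∈ K ↔ r ∈ Set.Iic (gauge K (w : Rn n))⁻¹ := by
      rw [← hK.gauge_le_one_iff, IsSymmConvexBody.gauge_smul hr.le, Set.mem_Iic, le_inv_comm₀ hr hN,
        ← one_div, le_div_iff₀ hr, mul_comm]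
    by_cases h : r • (w : Rn n) ∈ K
    · rw [Set.indicator_of_mem h, Set.indicator_of_mem (hmem.1 h),
        ← ENNReal.ofReal_mul (by positivity), inner_smul_right, abs_mul, abs_of_pos hr,
        Real.mul_rpow hr.le (abs_nonneg _), mul_comm]
    · rw [Set.indicator_of_notMem h, Set.indicator_of_notMem (fun h' => h (hmem.2 h')), mul_zero]
  have e : ∫⁻ r in Set.Ioi (0 : ℝ), ENNReal.ofReal (r ^ (n - 1)) *
        K.indicator (fun y => ENNReal.ofReal (|inner ℝ z y| ^ p)) (r • (w : Rn n))
      = ENNReal.ofReal (|inner ℝ z (w : Rn n)| ^ p) * ∫⁻ r in Set.Ioi (0 : ℝ),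
          ENNReal.ofReal (r ^ (n - 1)) *
          (Set.Iic (gauge K (w : Rn n))⁻¹).indicator (fun r => ENNReal.ofReal (r ^ p)) r := by
    rw [← lintegral_const_mul' _ _ ENNReal.ofReal_ne_top]
    refine setLIntegral_congr_fun measurableSet_Ioi fun r hr => ?_
    rw [key r hr, mul_left_comm]
  -- The radial integral is `N ^ (-(n+p)) / (n+p)`; the normalising factor `2 · (n+p)/2` cancels the
  -- denominator.
  rw [e, lintegral_Ioi_pow_mul_indicator hn (by linarith : 0 ≤ p) (inv_nonneg.2 hN.le)
      (fun r _ => rfl), ← ENNReal.ofReal_mul (by positivity),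
    show 2 * ENNReal.ofReal ((n + p) / 2) = ENNReal.ofReal (n + p) by
      rw [← ENNReal.ofReal_ofNat 2, ← ENNReal.ofReal_mul (by norm_num)]; congr 1; ring,
    ← ENNReal.ofReal_mul (by positivity), Real.inv_rpow hN.le]
  congr 1
  field_simp

lemma two_div_mul_eq_ofReal_inv_mul (hn : 1 ≤ n) (a : ℝ≥0∞) :
    2 / (n : ℝ≥0∞) * a = ENNReal.ofReal (n : ℝ)⁻¹ * (2 * a) := by
  rw [ENNReal.ofReal_inv_of_pos (by positivity), ENNReal.ofReal_natCast, div_eq_mul_inv]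
  ring

/-- Dividing by `r` leaves `r ^ (n/p)` against a constant. On a ray the inequality therefore cuts
out an initial segment, and equality a single possible endpoint. -/
lemma rpow_le_mul_iff_le {n : ℕ} (hn : 1 ≤ n) {p : ℝ} (hp : 1 ≤ p) {r N a : ℝ} (hr : 0 < r)
    (hN : 0 < N) (ha : 0 ≤ a) :
    ((r * N) ^ ((n : ℝ) / p + 1) ≤ r * a ↔ r ≤ (a / N ^ ((n : ℝ) / p + 1)) ^ (p / n)) ∧
    ((r * N) ^ ((n : ℝ) / p + 1) = r * a ↔ r = (a / N ^ ((n : ℝ) / p + 1)) ^ (p / n)) := by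
  have hn' : (0 : ℝ) < n := by positivity
  have hp' : 0 < p := by linarith
  have hNs : 0 < N ^ ((n : ℝ) / p + 1) := by positivity
  have h1 : (r * N) ^ ((n : ℝ) / p + 1) = r * (r ^ ((n : ℝ) / p) * N ^ ((n : ℝ) / p + 1)) := by
    rw [Real.mul_rpow hr.le hN.le, Real.rpow_add hr, Real.rpow_one]; ring
  have h2 : r = (r ^ ((n : ℝ) / p)) ^ (p / n) := by
    rw [← Real.rpow_mul hr.le, div_mul_div_cancel₀ hp'.ne', div_self hn'.ne', Real.rpow_one]
  have hpn : 0 < p / n := by positivity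
  rw [h1, mul_le_mul_iff_right₀ hr, mul_right_inj' hr.ne', ← le_div_iff₀ hNs, ← eq_div_iff hNs.ne']
  constructor
  · conv_rhs => lhs; rw [h2]
    rw [Real.rpow_le_rpow_iff (by positivity) (by positivity) hpn]
  · conv_rhs => lhs; rw [h2]
    rw [Real.rpow_left_inj (by positivity) (by positivity) hpn.ne']

/-- The volume of the cone-like set `{v | ‖v‖_K ^ (n / p + 1) ≤ |z · v|}`. -/
lemma volume_gauge_rpow_le_abs_inner (hn : 1 ≤ n) (hK : IsSymmConvexBody K) (hp : 1 ≤ p)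
    (z : Rn n) :
    volume {v : Rn n | gauge K v ^ ((n : ℝ) / p + 1) ≤ |inner ℝ z v|}
      = 2 / (n : ℝ≥0∞) * polarMomentNormPow K p z := by
  have hgc := hK.continuous_gauge
  have hn' : (0 : ℝ) < n := by positivity
  have hp' : 0 < p := by linarith
  have hS : MeasurableSet {v : Rn n | gauge K v ^ ((n : ℝ) / p + 1) ≤ |inner ℝ z v|} :=
    measurableSet_le (hgc.measurable.pow_const _) (by fun_prop)
  rw [two_div_mul_eq_ofReal_inv_mul hn, polarMomentNormPow_eq_lintegral_sphere hn hK hp,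
    ← lintegral_indicator_one hS, Rn.lintegral_polar hn (measurable_one.indicator hS),
    ← lintegral_const_mul' _ _ ENNReal.ofReal_ne_top]
  refine lintegral_congr fun w => ?_
  have hN := hK.gauge_pos (Rn.ne_zero_of_mem_sphere w)
  rw [lintegral_Ioi_pow_mul_indicator hn (le_refl (0 : ℝ))
    (b := (|inner ℝ z (w : Rn n)| / gauge K (w : Rn n) ^ ((n : ℝ) / p + 1)) ^ (p / n))
    (by positivity)]
  · rw [← ENNReal.ofReal_mul (by positivity), add_zero, Real.rpow_natCast, ← Real.rpow_mul_natCast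
      (by positivity), div_mul_cancel₀ _ hn'.ne', Real.div_rpow (by positivity) (by positivity),
      ← Real.rpow_mul hN.le, show ((n : ℝ) / p + 1) * p = n + p by field_simp, inv_mul_eq_div]
  · intro r hr
    have := (rpow_le_mul_iff_le hn hp hr hN (abs_nonneg (inner ℝ z (w : Rn n)))).1
    simp only [Set.indicator, Set.mem_ofPred_eq, Set.mem_Iic, Real.rpow_zero, ENNReal.ofReal_one,
      Pi.one_apply, IsSymmConvexBody.gauge_smul hr.le, inner_smul_right, abs_mul, abs_of_pos hr,
      this]

/-- Each open ray meets this set in at most one point. Its nullity makes the indicators of the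
rescaled superlevel sets converge a.e. -/
lemma volume_gauge_rpow_eq_abs_inner (hn : 1 ≤ n) (hK : IsSymmConvexBody K) (hp : 1 ≤ p)
    (z : Rn n) :
    volume {v : Rn n | gauge K v ^ ((n : ℝ) / p + 1) = |inner ℝ z v|} = 0 := by
  have hgc := hK.continuous_gauge
  have hS : MeasurableSet {v : Rn n | gauge K v ^ ((n : ℝ) / p + 1) = |inner ℝ z v|} :=
    measurableSet_eq_fun (hgc.measurable.pow_const _) (by fun_prop)
  rw [← lintegral_indicator_one hS, Rn.lintegral_polar hn (measurable_one.indicator hS)]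
  refine lintegral_eq_zero_of_ae_eq_zero (ae_of_all _ fun w => ?_)
  have hN := hK.gauge_pos (Rn.ne_zero_of_mem_sphere w)
  set b := (|inner ℝ z (w : Rn n)| / gauge K (w : Rn n) ^ ((n : ℝ) / p + 1)) ^ (p / n)
  refine lintegral_eq_zero_of_ae_eq_zero ?_
  have hb : ∀ᵐ r : ℝ ∂volume.restrict (Set.Ioi 0), r ≠ b :=
    ae_restrict_of_ae (Measure.ae_ne volume b)
  filter_upwards [hb, ae_restrict_mem measurableSet_Ioi] with r hrb hr
  have := (rpow_le_mul_iff_le hn hp hr hN (abs_nonneg (inner ℝ z (w : Rn n)))).2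
  rw [Set.indicator_of_notMem, mul_zero, Pi.zero_apply]
  simp only [Set.mem_ofPred_eq, IsSymmConvexBody.gauge_smul (le_of_lt hr), inner_smul_right,
    abs_mul, abs_of_pos (show 0 < r from hr), this]
  exact hrb

end PolarMoment

/-! ### Differences along segments. -/

section Gradient

variable {n : ℕ} {f : Rn n → ℝ}

lemma inner_gradient_eq_fderiv (x w : Rn n) : inner ℝ (∇ f x) w = fderiv ℝ f x w := by
  rw [gradient, InnerProductSpace.toDual_symm_apply]

lemma continuous_gradient (hf : ContDiff ℝ 1 f) : Continuous (∇ f) := by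
  unfold gradient
  exact (LinearIsometryEquiv.continuous _).comp (hf.continuous_fderiv one_ne_zero)

lemma hasDerivAt_comp_line (hf : ContDiff ℝ 1 f) (x w : Rn n) (s : ℝ) :
    HasDerivAt (fun s : ℝ => f (x + s • w)) (inner ℝ (∇ f (x + s • w)) w) s := by
  rw [inner_gradient_eq_fderiv]
  have h1 : HasDerivAt (fun s : ℝ => x + s • w) w s := by
    simpa using ((hasDerivAt_id s).smul_const w).const_add x
  exact ((hf.differentiable one_ne_zero) _).hasFDerivAt.comp_hasDerivAt s h1

/-- Hölder's inequality for the fundamental theorem of calculus along a segment. -/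
lemma ofReal_abs_sub_rpow_le (hf : ContDiff ℝ 1 f) {p : ℝ} (hp : 1 ≤ p) (x w : Rn n) {r : ℝ}
    (hr : 0 < r) :
    ENNReal.ofReal (|f (x + r • w) - f x| ^ p) ≤ ENNReal.ofReal (r ^ (p - 1)) *
      ∫⁻ s in Set.Icc 0 r, ENNReal.ofReal (|inner ℝ (∇ f (x + s • w)) w| ^ p) := by
  have hp' : 0 < p := by linarith
  have hc : Continuous fun s : ℝ => inner ℝ (∇ f (x + s • w)) w :=
    ((continuous_gradient hf).comp (by fun_prop)).inner continuous_const
  have hftc : ∫ s in (0 : ℝ)..r, inner ℝ (∇ f (x + s • w)) w = f (x + r • w) - f x := by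
    rw [intervalIntegral.integral_eq_sub_of_hasDerivAt
      (fun s _ => hasDerivAt_comp_line hf x w s) (hc.intervalIntegrable _ _)]
    simp
  rw [intervalIntegral.integral_of_le hr.le] at hftc
  set φ : ℝ → ℝ := fun s => inner ℝ (∇ f (x + s • w)) w with hφ
  set μ := (volume : Measure ℝ).restrict (Set.Ioc 0 r) with hμ
  have h1 : ‖f (x + r • w) - f x‖ₑ ≤ eLpNorm' φ 1 μ := by
    rw [← hftc, eLpNorm']
    simpa using enorm_integral_le_lintegral_enorm φ
  -- Passing from `L^1` to `L^p` on an interval of length `r` costs `r ^ (1 - 1/p)`, hence `r ^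
  -- (p-1)` after taking `p`-th powers.
  have h2 := eLpNorm'_le_eLpNorm'_mul_rpow_measure_univ (μ := μ) one_pos hp
    hc.aestronglyMeasurable
  have h3 : μ Set.univ = ENNReal.ofReal r := by simp [hμ]
  have h4 := ENNReal.rpow_le_rpow (h1.trans h2) hp'.le
  have hen : ∀ a : ℝ, ‖a‖ₑ ^ p = ENNReal.ofReal (|a| ^ p) := fun a => by
    rw [Real.enorm_eq_ofReal_abs, ENNReal.ofReal_rpow_of_nonneg (abs_nonneg _) hp'.le]
  rw [ENNReal.mul_rpow_of_nonneg _ _ hp'.le, h3, ← ENNReal.rpow_mul, eLpNorm',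
    ← ENNReal.rpow_mul, one_div_mul_cancel hp'.ne', ENNReal.rpow_one, hen, mul_comm,
    ENNReal.ofReal_rpow_of_pos hr] at h4
  simp only [hen] at h4
  rw [show (1 / 1 - 1 / p) * p = p - 1 by field_simp] at h4
  exact h4.trans (mul_le_mul_right (lintegral_mono_set Set.Ioc_subset_Icc_self) _)

end Gradient

/-! ### The upper weak-type bound for the gradient energy. -/

section Upper

variable {n : ℕ} {K : Set (Rn n)} {f : Rn n → ℝ}

lemma measurableSet_superlevelSet (hK : IsSymmConvexBody K) (s : ℝ) (hf : Measurable f) (t : ℝ) :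
    MeasurableSet (superlevelSet K s f t) := by
  have := hK.continuous_gauge.measurable
  have h : MeasurableSet {z : Rn n × Rn n | t ≤ |f z.1 - f z.2| / gauge K (z.1 - z.2) ^ s} :=
    measurableSet_le measurable_const (by fun_prop)
  exact (measurableSet_eq_fun measurable_fst measurable_snd).compl.inter h

lemma mem_superlevelSet_iff (hK : IsSymmConvexBody K) {s t : ℝ} {z : Rn n × Rn n} :
    z ∈ superlevelSet K s f t ↔ z.1 ≠ z.2 ∧ t * gauge K (z.1 - z.2) ^ s ≤ |f z.1 - f z.2| := by
  refine and_congr_right fun h => ?_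
  have := hK.gauge_pos (sub_ne_zero.2 h)
  rw [le_div_iff₀ (by positivity)]

/-- The quotient is `0` on the diagonal, so a positive level excludes it automatically. -/
lemma setOf_le_abs_anisotropicQuotient {s t : ℝ} (ht : 0 < t) :
    {z | t ≤ |anisotropicQuotient K s f z|} = superlevelSet K s f t := by
  ext z
  have hN : 0 ≤ gauge K (z.1 - z.2) ^ s := Real.rpow_nonneg (gauge_nonneg _) _
  simp only [anisotropicQuotient, superlevelSet, Set.mem_ofPred_eq, abs_div, abs_of_nonneg hN]
  refine ⟨fun h => ⟨fun h' => ?_, h⟩, fun h => h.2⟩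
  rw [h'] at h
  simp at h
  linarith

lemma weakLpQuasinormPow_eq_iSup_superlevelSet (p s : ℝ) :
    weakLpQuasinormPow p (anisotropicQuotient K s f)
      = ⨆ (t : ℝ) (_ : 0 < t), ENNReal.ofReal (t ^ p) * volume (superlevelSet K s f t) := by
  unfold weakLpQuasinormPow
  refine iSup_congr fun t => iSup_congr fun ht => ?_
  rw [setOf_le_abs_anisotropicQuotient ht]

lemma volume_eq_lintegral_translate {S : Set (Rn n × Rn n)} (hS : MeasurableSet S) :
    volume S = ∫⁻ x, ∫⁻ v, S.indicator (1 : Rn n × Rn n → ℝ≥0∞) (x, x + v) := by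
  rw [Measure.volume_eq_prod, ← lintegral_indicator_one hS,
    lintegral_prod _ (measurable_one.indicator hS).aemeasurable]
  refine lintegral_congr fun x => ?_
  rw [lintegral_add_left_eq_self (fun v => S.indicator (1 : Rn n × Rn n → ℝ≥0∞) (x, v)) x]

/-- Integration over pairs of points by the rotation method. -/
lemma volume_eq_lintegral_sphere (hn : 1 ≤ n) {S : Set (Rn n × Rn n)} (hS : MeasurableSet S) :
    volume S = ∫⁻ w : Metric.sphere (0 : Rn n) 1, ∫⁻ x, ∫⁻ r in Set.Ioi (0 : ℝ),
      ENNReal.ofReal (r ^ (n - 1)) *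
        S.indicator (1 : Rn n × Rn n → ℝ≥0∞) (x, x + r • (w : Rn n)) ∂volume ∂volume
          ∂(volume : Measure (Rn n)).toSphere := by
  have hI : Measurable (S.indicator (1 : Rn n × Rn n → ℝ≥0∞)) := measurable_one.indicator hS
  have hm : Measurable fun q : (Rn n × Metric.sphere (0 : Rn n) 1) × ℝ =>
      ENNReal.ofReal (q.2 ^ (n - 1)) *
        S.indicator (1 : Rn n × Rn n → ℝ≥0∞) (q.1.1, q.1.1 + q.2 • (q.1.2 : Rn n)) := by
    refine Measurable.mul (by fun_prop) (hI.comp ?_)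
    fun_prop
  have hm' : Measurable (Function.uncurry fun (x : Rn n) (w : Metric.sphere (0 : Rn n) 1) =>
      ∫⁻ r in Set.Ioi (0 : ℝ), ENNReal.ofReal (r ^ (n - 1)) *
        S.indicator (1 : Rn n × Rn n → ℝ≥0∞) (x, x + r • (w : Rn n))) :=
    Measurable.lintegral_prod_right' hm
  rw [volume_eq_lintegral_translate hS, ← lintegral_lintegral_swap hm'.aemeasurable]
  refine lintegral_congr fun x => ?_
  exact Rn.lintegral_polar hn (g := fun v => S.indicator 1 (x, x + v)) (hI.comp (by fun_prop))

/-- The weak-type estimate along the lines of a fixed direction. -/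
lemma lintegral_superlevelSet_direction_le (hn : 1 ≤ n) (hK : IsSymmConvexBody K)
    (hf : ContDiff ℝ 1 f) {M : ℝ} (hM : ∀ x, |f x| ≤ M) {p : ℝ} (hp : 1 ≤ p) {w : Rn n}
    (hw : w ≠ 0) {t : ℝ} (ht : 0 < t) :
    ENNReal.ofReal (t ^ p) * ∫⁻ x, ∫⁻ r in Set.Ioi (0 : ℝ), ENNReal.ofReal (r ^ (n - 1)) *
        (superlevelSet K (n / p + 1) f t).indicator (1 : Rn n × Rn n → ℝ≥0∞) (x, x + r • w)
      ≤ 2 * ENNReal.ofReal (5 ^ (n + 1)) *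
        ∫⁻ x, ENNReal.ofReal (|inner ℝ (∇ f x) w| ^ p / gauge K w ^ (n + p)) := by
  have hp' : 0 < p := by linarith
  have hN := hK.gauge_pos hw
  set N := gauge K w with hNdef
  -- An a priori bound on `r`: for `r > 1`, membership gives `t r N ^ (n/p+1) ≤ t (r N) ^ (n/p+1) ≤
  -- 2M`. The final estimate does not involve `R` or `M`.
  set R := max 1 (2 * M / (t * N ^ ((n : ℝ) / p + 1))) with hR
  have hR0 : 0 < R := lt_max_of_lt_left one_pos
  have hgm : Measurable (∇ f) := (continuous_gradient hf).measurable
  have hFm : Measurable fun x => ENNReal.ofReal (|inner ℝ (∇ f x) w| ^ p) := by fun_prop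
  have key := lintegral_heavy_segments_le volume hn hFm w (ENNReal.ofReal (t ^ p * N ^ (n + p))) hR0
  have hNp : 0 < N ^ ((n : ℝ) + p) := by positivity
  have hcancel : ENNReal.ofReal (N ^ ((n : ℝ) + p))⁻¹ * ENNReal.ofReal (t ^ p * N ^ ((n : ℝ) + p))
      = ENNReal.ofReal (t ^ p) := by
    rw [← ENNReal.ofReal_mul (by positivity)]
    congr 1
    field_simp
  have key2 := mul_le_mul_right key (ENNReal.ofReal (N ^ ((n : ℝ) + p))⁻¹)
  rw [← mul_assoc, hcancel, mul_left_comm,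
    ← lintegral_const_mul' (ENNReal.ofReal (N ^ ((n : ℝ) + p))⁻¹) _ ENNReal.ofReal_ne_top] at key2
  have e : ∀ x, ENNReal.ofReal (N ^ ((n : ℝ) + p))⁻¹ * ENNReal.ofReal (|inner ℝ (∇ f x) w| ^ p)
      = ENNReal.ofReal (|inner ℝ (∇ f x) w| ^ p / N ^ (n + p)) := fun x => by
    rw [← ENNReal.ofReal_mul (by positivity), inv_mul_eq_div]
  simp only [e] at key2
  refine le_trans ?_ key2
  refine mul_le_mul_right (lintegral_mono fun x => ?_) _
  rw [← lintegral_indicator measurableSet_Ioi]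
  refine lintegral_mono fun r => ?_
  by_cases h0 : r ∈ Set.Ioi (0 : ℝ)
  swap
  · rw [Set.indicator_of_notMem h0]; exact zero_le
  rw [Set.indicator_of_mem h0]
  by_cases hS : (x, x + r • w) ∈ superlevelSet K (n / p + 1) f t
  swap
  · rw [Set.indicator_of_notMem hS, mul_zero]; exact zero_le
  have h0' : 0 < r := h0
  rw [Set.indicator_of_mem hS, Pi.one_apply, mul_one]
  rw [Set.indicator_of_mem]
  rw [mem_superlevelSet_iff hK, hK.gauge_sub_comm, add_sub_cancel_left,
    IsSymmConvexBody.gauge_smul h0'.le, ← hNdef, abs_sub_comm] at hS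
  have h2 := hS.2
  rw [Real.mul_rpow h0'.le hN.le] at h2
  refine ⟨⟨h0', ?_⟩, ?_⟩
  · by_contra! hlt
    simp only at hlt
    have h1r : 1 < r := (le_max_left _ _).trans_lt hlt
    have h2r := (le_max_right _ _).trans_lt hlt
    rw [div_lt_iff₀ (by positivity)] at h2r
    have h3 : |f (x + r • w) - f x| ≤ 2 * M := by
      have := abs_sub (f (x + r • w)) (f x)
      linarith [hM (x + r • w), hM x]
    have h4 : r ≤ r ^ ((n : ℝ) / p + 1) := by
      conv_lhs => rw [← Real.rpow_one r]
      refine Real.rpow_le_rpow_of_exponent_le h1r.le ?_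
      have : 0 ≤ (n : ℝ) / p := by positivity
      linarith
    have h5 : r * (t * N ^ ((n : ℝ) / p + 1)) ≤
        t * (r ^ ((n : ℝ) / p + 1) * N ^ ((n : ℝ) / p + 1)) := by
      have := mul_le_mul_of_nonneg_right h4 (by positivity : 0 ≤ t * N ^ ((n : ℝ) / p + 1))
      linarith
    linarith
  · simp only
    have h3 := (ENNReal.ofReal_le_ofReal (Real.rpow_le_rpow (by positivity) h2 hp'.le)).trans
      (ofReal_abs_sub_rpow_le hf hp x w h0')
    -- The split `n + p = (p - 1) + (n + 1)` isolates the Hölder factor `r ^ (p-1)`; what remains is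
    -- exactly the heaviness threshold with `c = t ^ p N ^ (n+p)`.
    have h4 : (t * (r ^ ((n : ℝ) / p + 1) * N ^ ((n : ℝ) / p + 1))) ^ p
        = r ^ (p - 1) * (t ^ p * N ^ (n + p) * r ^ (n + 1)) := by
      rw [Real.mul_rpow ht.le (by positivity), Real.mul_rpow (by positivity) (by positivity),
        ← Real.rpow_mul h0'.le, ← Real.rpow_mul hN.le,
        show ((n : ℝ) / p + 1) * p = n + p by field_simp, ← Real.rpow_natCast r (n + 1),
        show ((n : ℝ) + p) = (p - 1) + ((n + 1 : ℕ) : ℝ) by push_cast; ring, Real.rpow_add h0']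
      ring
    rw [h4, ENNReal.ofReal_mul (by positivity)] at h3
    rw [← ENNReal.ofReal_mul (by positivity)]
    exact (ENNReal.mul_le_mul_iff_right (by simpa using Real.rpow_pos_of_pos h0' _)
      ENNReal.ofReal_ne_top).1 h3

/-- The upper Marcinkiewicz bound for smooth functions. -/
lemma ofReal_rpow_mul_volume_superlevelSet_le (hn : 1 ≤ n) (hK : IsSymmConvexBody K)
    (hf : ContDiff ℝ 1 f) {M : ℝ} (hM : ∀ x, |f x| ≤ M) {p : ℝ} (hp : 1 ≤ p)
    {t : ℝ} (ht : 0 < t) :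
    ENNReal.ofReal (t ^ p) * volume (superlevelSet K (n / p + 1) f t)
      ≤ 4 * ENNReal.ofReal (5 ^ (n + 1)) * anisotropicEnergy K p f := by
  have hgm : Measurable (∇ f) := (continuous_gradient hf).measurable
  have hgK := hK.continuous_gauge.measurable
  have hm : Measurable (Function.uncurry fun (w : Metric.sphere (0 : Rn n) 1) (x : Rn n) =>
      ENNReal.ofReal (|inner ℝ (∇ f x) (w : Rn n)| ^ p / gauge K (w : Rn n) ^ (n + p))) := by
    unfold Function.uncurry
    fun_prop
  rw [volume_eq_lintegral_sphere hn (measurableSet_superlevelSet hK _ hf.continuous.measurable t),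
    ← lintegral_const_mul' _ _ ENNReal.ofReal_ne_top]
  calc
    _ ≤ ∫⁻ w : Metric.sphere (0 : Rn n) 1, 2 * ENNReal.ofReal (5 ^ (n + 1)) *
        ∫⁻ x, ENNReal.ofReal (|inner ℝ (∇ f x) (w : Rn n)| ^ p / gauge K (w : Rn n) ^ (n + p))
        ∂volume ∂(volume : Measure (Rn n)).toSphere :=
      lintegral_mono fun w => lintegral_superlevelSet_direction_le hn hK hf hM hp
        (Rn.ne_zero_of_mem_sphere w) ht
    _ = 2 * ENNReal.ofReal (5 ^ (n + 1)) * ∫⁻ x, 2 * polarMomentNormPow K p (∇ f x) := by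
      rw [lintegral_const_mul' _ _ (ENNReal.mul_ne_top (by simp) ENNReal.ofReal_ne_top),
        lintegral_lintegral_swap hm.aemeasurable]
      simp only [polarMomentNormPow_eq_lintegral_sphere hn hK hp]
    _ = _ := by
      rw [lintegral_const_mul' _ _ (by simp), anisotropicEnergy]
      ring

end Upper

/-! ### The limit for smooth functions as the level tends to infinity. -/

section SmoothLimit

variable {n : ℕ} {K : Set (Rn n)} {f : Rn n → ℝ}

/-- Rescaling of the difference variable in a set of pairs. -/
lemma volume_preimage_shear {S : Set (Rn n × Rn n)} (hS : MeasurableSet S) {τ : ℝ} (hτ : 0 < τ) :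
    volume ((fun z : Rn n × Rn n => (z.1, z.1 + τ • z.2)) ⁻¹' S)
      = ENNReal.ofReal (τ ^ n)⁻¹ * volume S := by
  have hm : MeasurableSet ((fun z : Rn n × Rn n => (z.1, z.1 + τ • z.2)) ⁻¹' S) :=
    (by fun_prop : Measurable fun z : Rn n × Rn n => (z.1, z.1 + τ • z.2)) hS
  rw [Measure.volume_eq_prod, Measure.prod_apply hm, Measure.prod_apply hS,
    ← lintegral_const_mul' _ _ ENNReal.ofReal_ne_top]
  refine lintegral_congr fun x => ?_
  have h1 : Prod.mk x ⁻¹' ((fun z : Rn n × Rn n => (z.1, z.1 + τ • z.2)) ⁻¹' S)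
      = (fun v : Rn n => τ • v) ⁻¹' ((fun v => x + v) ⁻¹' (Prod.mk x ⁻¹' S)) := rfl
  rw [h1, Measure.addHaar_preimage_smul _ hτ.ne', measure_preimage_add,
    finrank_euclideanSpace_fin, abs_of_pos (by positivity)]

/-- The scale `τ = t ^ (-p/n)` solves `t τ ^ (n/p+1) = τ`, so the level disappears and a difference
quotient remains. The Jacobian `τ ^ (-n)` is then exactly `t ^ p`. -/
lemma shear_mem_superlevelSet_iff (hn : 1 ≤ n) (hK : IsSymmConvexBody K) {p : ℝ} (hp : 1 ≤ p)
    {t : ℝ} (ht : 0 < t) {x v : Rn n} :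
    (x, x + t ^ (-(p / n)) • v) ∈ superlevelSet K (n / p + 1) f t ↔
      v ≠ 0 ∧ gauge K v ^ ((n : ℝ) / p + 1)
        ≤ |(t ^ (-(p / n)))⁻¹ * (f (x + t ^ (-(p / n)) • v) - f x)| := by
  have hp' : 0 < p := by linarith
  have hn' : (0 : ℝ) < n := by positivity
  have hτ : 0 < t ^ (-(p / n)) := by positivity
  have hτt : (t ^ (-(p / n))) ^ ((n : ℝ) / p + 1) * t = t ^ (-(p / n)) := by
    rw [Real.rpow_add hτ, Real.rpow_one, ← Real.rpow_mul ht.le,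
      show -(p / (n : ℝ)) * (n / p) = -1 by field_simp, Real.rpow_neg_one, mul_right_comm,
      inv_mul_cancel₀ ht.ne', one_mul]
  set τ := t ^ (-(p / n))
  rw [mem_superlevelSet_iff hK, hK.gauge_sub_comm, add_sub_cancel_left,
    IsSymmConvexBody.gauge_smul hτ.le, abs_sub_comm, Real.mul_rpow hτ.le (gauge_nonneg _),
    abs_mul, abs_of_pos (inv_pos.2 hτ), ← mul_assoc, mul_comm t, hτt, le_inv_mul_iff₀ hτ]
  simp [hτ.ne']

lemma measurableSet_gauge_rpow_le_abs_inner_gradient (hK : IsSymmConvexBody K)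
    (hf : ContDiff ℝ 1 f) (s : ℝ) :
    MeasurableSet {z : Rn n × Rn n | gauge K z.2 ^ s ≤ |inner ℝ (∇ f z.1) z.2|} := by
  have hgm : Measurable (∇ f) := (continuous_gradient hf).measurable
  have hgK := hK.continuous_gauge.measurable
  exact measurableSet_le (by fun_prop) (by fun_prop)

lemma volume_gauge_rpow_le_abs_inner_gradient (hn : 1 ≤ n) (hK : IsSymmConvexBody K)
    (hf : ContDiff ℝ 1 f) {p : ℝ} (hp : 1 ≤ p) :
    volume {z : Rn n × Rn n | gauge K z.2 ^ ((n : ℝ) / p + 1) ≤ |inner ℝ (∇ f z.1) z.2|}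
      = 2 / (n : ℝ≥0∞) * anisotropicEnergy K p f := by
  have hm := measurableSet_gauge_rpow_le_abs_inner_gradient hK hf ((n : ℝ) / p + 1)
  have hn0 : (n : ℝ≥0∞) ≠ 0 := by simpa using (show n ≠ 0 by omega)
  rw [Measure.volume_eq_prod, Measure.prod_apply hm, anisotropicEnergy,
    ← lintegral_const_mul' _ _ (ENNReal.div_ne_top (by simp) hn0)]
  exact lintegral_congr fun x => volume_gauge_rpow_le_abs_inner hn hK hp (∇ f x)

lemma ae_gauge_rpow_ne_abs_inner_gradient (hn : 1 ≤ n) (hK : IsSymmConvexBody K)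
    (hf : ContDiff ℝ 1 f) {p : ℝ} (hp : 1 ≤ p) :
    ∀ᵐ z : Rn n × Rn n, gauge K z.2 ^ ((n : ℝ) / p + 1) ≠ |inner ℝ (∇ f z.1) z.2| := by
  have hgm : Measurable (∇ f) := (continuous_gradient hf).measurable
  have hgK := hK.continuous_gauge.measurable
  have hm : MeasurableSet
      {z : Rn n × Rn n | gauge K z.2 ^ ((n : ℝ) / p + 1) = |inner ℝ (∇ f z.1) z.2|} :=
    measurableSet_eq_fun (by fun_prop) (by fun_prop)
  rw [ae_iff]
  simp only [not_not]
  rw [Measure.volume_eq_prod]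
  refine Measure.measure_prod_null_of_ae_null hm (ae_of_all _ fun x => ?_)
  exact volume_gauge_rpow_eq_abs_inner hn hK hp (∇ f x)

lemma tendsto_difference_quotient (hf : ContDiff ℝ 1 f) (x v : Rn n) :
    Tendsto (fun τ : ℝ => τ⁻¹ * (f (x + τ • v) - f x)) (𝓝[>] 0) (𝓝 (inner ℝ (∇ f x) v)) := by
  have h := (hasDerivAt_comp_line hf x v 0).tendsto_slope_zero_right
  simpa using h

/-- All rescaled superlevel sets with large parameter lie in one bounded set. -/
lemma exists_bounded_superset_of_lipschitz (hn : 1 ≤ n) (hK : IsSymmConvexBody K)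
    (hf : ContDiff ℝ 1 f) (hc : HasCompactSupport f) {p : ℝ} (hp : 1 ≤ p) :
    ∃ R : ℝ, ∀ x v : Rn n, ∀ τ : ℝ, 0 < τ → τ ≤ 1 → v ≠ 0 →
      gauge K v ^ ((n : ℝ) / p + 1) ≤ |τ⁻¹ * (f (x + τ • v) - f x)| → ‖x‖ ≤ R ∧ ‖v‖ ≤ R := by
  have hp' : 0 < p := by linarith
  have hn' : (0 : ℝ) < n := by positivity
  obtain ⟨L, hL⟩ := hf.lipschitzWith_of_hasCompactSupport hc one_ne_zero
  obtain ⟨c, hc0, hcN⟩ := hK.exists_norm_le_mul_gauge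
  obtain ⟨R0, hR0, hsupp⟩ := hc.isCompact.isBounded.exists_pos_norm_le
  -- The Lipschitz bound gives `N(v) ^ (n/p+1) ≤ L c N(v)`; cancelling `N(v)` yields `N(v) ≤ (L c) ^
  -- (p/n)`.
  set R2 := c * (L * c) ^ (p / n) with hR2
  have hR2' : 0 ≤ R2 := by positivity
  refine ⟨R0 + R2, fun x v τ hτ hτ1 hv h => ?_⟩
  have hN := hK.gauge_pos hv
  have hv2 : ‖v‖ ≤ R2 := by
    have h1 : |τ⁻¹ * (f (x + τ • v) - f x)| ≤ L * c * gauge K v := by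
      rw [abs_mul, abs_of_pos (inv_pos.2 hτ), inv_mul_le_iff₀ hτ]
      have h2 := hL.dist_le_mul (x + τ • v) x
      rw [Real.dist_eq, dist_eq_norm, add_sub_cancel_left, norm_smul, Real.norm_of_nonneg hτ.le]
        at h2
      calc _ ≤ L * (τ * ‖v‖) := h2
        _ ≤ L * (τ * (c * gauge K v)) := by gcongr; exact hcN v
        _ = _ := by ring
    have h3 := h.trans h1
    rw [Real.rpow_add hN, Real.rpow_one, mul_le_mul_iff_left₀ hN] at h3
    have h4 := Real.rpow_le_rpow (by positivity) h3 (by positivity : 0 ≤ p / n)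
    rw [← Real.rpow_mul hN.le, div_mul_div_cancel₀ hp'.ne', div_self hn'.ne', Real.rpow_one] at h4
    calc _ ≤ c * gauge K v := hcN v
      _ ≤ _ := by rw [hR2]; gcongr
  refine ⟨?_, by linarith⟩
  -- A nonzero difference puts `x` or `x + τ v` in the support, and `τ ≤ 1` keeps the two points
  -- within `‖v‖` of each other.
  have hpos : 0 < |τ⁻¹ * (f (x + τ • v) - f x)| := lt_of_lt_of_le (by positivity) h
  by_cases hx : x ∈ tsupport f
  · linarith [hsupp x hx]
  · have hfx : f x = 0 := image_eq_zero_of_notMem_tsupport hx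
    have hx' : x + τ • v ∈ tsupport f := by
      by_contra hx'
      rw [hfx, image_eq_zero_of_notMem_tsupport hx'] at hpos
      simp at hpos
    have h5 := hsupp _ hx'
    have h6 : ‖x‖ ≤ ‖x + τ • v‖ + ‖τ • v‖ := by
      simpa using norm_sub_le (x + τ • v) (τ • v)
    have h7 : ‖τ • v‖ ≤ ‖v‖ := by
      rw [norm_smul, Real.norm_of_nonneg hτ.le]
      exact mul_le_of_le_one_left (norm_nonneg _) hτ1
    linarith

/-- Dominated convergence for the indicators of the sheared sets: away from the null equality set, a
strict inequality for `|∇f(x) · v|` passes to the difference quotients at small scales. -/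
lemma tendsto_rpow_mul_volume_superlevelSet (hn : 1 ≤ n) (hK : IsSymmConvexBody K)
    (hf : ContDiff ℝ 1 f) (hc : HasCompactSupport f) {p : ℝ} (hp : 1 ≤ p) :
    Tendsto (fun t : ℝ => ENNReal.ofReal (t ^ p) * volume (superlevelSet K (n / p + 1) f t))
      atTop (𝓝 (2 / (n : ℝ≥0∞) * anisotropicEnergy K p f)) := by
  have hp' : 0 < p := by linarith
  have hn' : (0 : ℝ) < n := by positivity
  have hpn : 0 < p / n := by positivity
  obtain ⟨R, hR⟩ := exists_bounded_superset_of_lipschitz hn hK hf hc hp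
  have hSm := fun t => measurableSet_superlevelSet hK ((n : ℝ) / p + 1) hf.continuous.measurable t
  have hΦ : ∀ τ : ℝ, Measurable fun z : Rn n × Rn n => (z.1, z.1 + τ • z.2) := fun τ => by fun_prop
  have hτlim : Tendsto (fun t : ℝ => t ^ (-(p / n))) atTop (𝓝[>] 0) :=
    tendsto_nhdsWithin_iff.2 ⟨tendsto_rpow_neg_atTop hpn,
      (eventually_gt_atTop 0).mono fun t ht => Real.rpow_pos_of_pos ht _⟩
  have hlim := tendsto_measure_of_ae_tendsto_indicator (μ := (volume : Measure (Rn n × Rn n))) atTop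
    (measurableSet_gauge_rpow_le_abs_inner_gradient hK hf ((n : ℝ) / p + 1))
    (As := fun t : ℝ => (fun z : Rn n × Rn n => (z.1, z.1 + t ^ (-(p / n)) • z.2)) ⁻¹'
      superlevelSet K (n / p + 1) f t)
    (B := Metric.closedBall 0 R ×ˢ Metric.closedBall 0 R)
    (fun t => hΦ _ (hSm t)) (measurableSet_closedBall.prod measurableSet_closedBall) ?_ ?_ ?_
  · rw [volume_gauge_rpow_le_abs_inner_gradient hn hK hf hp] at hlim
    refine hlim.congr' ?_
    filter_upwards [eventually_gt_atTop 0] with t ht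
    rw [volume_preimage_shear (hSm t) (Real.rpow_pos_of_pos ht _), ← Real.rpow_mul_natCast ht.le,
      neg_mul, div_mul_cancel₀ _ hn'.ne', Real.rpow_neg ht.le, inv_inv]
  · exact ((isCompact_closedBall 0 R).prod (isCompact_closedBall 0 R)).measure_lt_top.ne
  · filter_upwards [eventually_ge_atTop 1] with t ht
    rintro ⟨x, v⟩ hz
    have ht0 : 0 < t := by linarith
    rw [Set.mem_preimage, shear_mem_superlevelSet_iff hn hK hp ht0] at hz
    have := hR x v _ (Real.rpow_pos_of_pos ht0 _)
      (Real.rpow_le_one_of_one_le_of_nonpos ht (by linarith)) hz.1 hz.2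
    simpa using this
  · filter_upwards [ae_gauge_rpow_ne_abs_inner_gradient hn hK hf hp] with z hz
    obtain ⟨x, v⟩ := z
    have hs : (n : ℝ) / p + 1 ≠ 0 := by positivity
    have hv : v ≠ 0 := by
      rintro rfl
      simp [gauge_zero, Real.zero_rpow hs] at hz
    have hq := ((tendsto_difference_quotient hf x v).comp hτlim).abs
    simp only [Function.comp_def] at hq
    rcases lt_or_gt_of_ne hz with h | h
    · filter_upwards [hq.eventually_const_lt h, eventually_gt_atTop 0] with t h1 ht
      rw [Set.mem_preimage, shear_mem_superlevelSet_iff hn hK hp ht]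
      exact iff_of_true ⟨hv, h1.le⟩ h.le
    · filter_upwards [hq.eventually_lt_const h, eventually_gt_atTop 0] with t h1 ht
      rw [Set.mem_preimage, shear_mem_superlevelSet_iff hn hK hp ht]
      exact iff_of_false (fun h2 => not_lt.2 h2.2 h1) (not_le.2 h)

end SmoothLimit

/-! ### Bounds for functions in `L^p`, and the limit under finite-measure support. -/

section LebesgueFunctions

variable {n : ℕ} {K : Set (Rn n)} {f g h : Rn n → ℝ} {p : ℝ}

lemma volume_setOf_fst_eq_snd (hn : 1 ≤ n) : volume {z : Rn n × Rn n | z.1 = z.2} = 0 := by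
  have := Rn.nontrivial hn
  rw [Measure.volume_eq_prod]
  refine Measure.measure_prod_null_of_ae_null (measurableSet_eq_fun measurable_fst measurable_snd)
    (ae_of_all _ fun x => ?_)
  have : Prod.mk x ⁻¹' {z : Rn n × Rn n | z.1 = z.2} = {x} := by
    ext y
    simp [eq_comm]
  simp only [this, measure_singleton, Pi.zero_apply]

lemma measurableSet_mul_gauge_rpow_le_abs_fst (hK : IsSymmConvexBody K) (hf : Measurable f)
    (s t : ℝ) : MeasurableSet {z : Rn n × Rn n | t * gauge K (z.1 - z.2) ^ s ≤ |f z.1|} := by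
  have hgK := hK.continuous_gauge.measurable
  exact measurableSet_le (by fun_prop) (by fun_prop)

/-- The fibre over `x` is a translate of the gauge ball of radius `(|f x| / t) ^ (p/n)`, of volume
`|K| |f x| ^ p / t ^ p`. The identity is exact at every level. -/
lemma ofReal_rpow_mul_volume_le_abs_fst (hn : 1 ≤ n) (hK : IsSymmConvexBody K) (hp : 1 ≤ p)
    (hf : Measurable f) {t : ℝ} (ht : 0 < t) :
    ENNReal.ofReal (t ^ p) *
        volume {z : Rn n × Rn n | t * gauge K (z.1 - z.2) ^ ((n : ℝ) / p) ≤ |f z.1|}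
      = volume K * ∫⁻ x, ‖f x‖ₑ ^ p := by
  have hp' : 0 < p := by linarith
  have hn' : (0 : ℝ) < n := by positivity
  rw [Measure.volume_eq_prod, Measure.prod_apply (measurableSet_mul_gauge_rpow_le_abs_fst hK hf _ _),
    ← lintegral_const_mul' _ _ ENNReal.ofReal_ne_top,
    ← lintegral_const_mul' _ _ hK.volume_lt_top.ne]
  refine lintegral_congr fun x => ?_
  have h1 : Prod.mk x ⁻¹' {z : Rn n × Rn n | t * gauge K (z.1 - z.2) ^ ((n : ℝ) / p) ≤ |f z.1|}
      = (fun y => y + -x) ⁻¹' {v | gauge K v ≤ (|f x| / t) ^ (p / n)} := by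
    ext y
    simp only [Set.mem_preimage, Set.mem_ofPred_eq]
    rw [← sub_eq_add_neg, hK.gauge_sub_comm x y, mul_comm, ← le_div_iff₀ ht,
      ← Real.rpow_le_rpow_iff (Real.rpow_nonneg (gauge_nonneg _) _) (by positivity)
        (by positivity : 0 < p / n), ← Real.rpow_mul (gauge_nonneg _),
      div_mul_div_cancel₀ hp'.ne', div_self hn'.ne', Real.rpow_one]
  rw [h1, measure_preimage_add_right, hK.volume_gauge_le hn (by positivity),
    ← Real.rpow_mul_natCast (by positivity), div_mul_cancel₀ _ hn'.ne', ← mul_assoc,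
    ← ENNReal.ofReal_mul (by positivity), Real.div_rpow (abs_nonneg _) ht.le,
    mul_div_cancel₀ _ (by positivity), Real.enorm_eq_ofReal_abs,
    ENNReal.ofReal_rpow_of_nonneg (abs_nonneg _) hp'.le, mul_comm]

lemma ofReal_rpow_mul_volume_le_abs_snd (hn : 1 ≤ n) (hK : IsSymmConvexBody K) (hp : 1 ≤ p)
    (hf : Measurable f) {t : ℝ} (ht : 0 < t) :
    ENNReal.ofReal (t ^ p) *
        volume {z : Rn n × Rn n | t * gauge K (z.1 - z.2) ^ ((n : ℝ) / p) ≤ |f z.2|}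
      = volume K * ∫⁻ x, ‖f x‖ₑ ^ p := by
  rw [← ofReal_rpow_mul_volume_le_abs_fst hn hK hp hf ht]
  congr 1
  have h1 : {z : Rn n × Rn n | t * gauge K (z.1 - z.2) ^ ((n : ℝ) / p) ≤ |f z.2|}
      = Prod.swap ⁻¹' {z : Rn n × Rn n | t * gauge K (z.1 - z.2) ^ ((n : ℝ) / p) ≤ |f z.1|} := by
    ext z
    simp only [Set.mem_preimage, Set.mem_ofPred_eq, Prod.fst_swap, Prod.snd_swap]
    rw [hK.gauge_sub_comm]
  rw [h1, Measure.volume_eq_prod]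
  exact (Measure.measurePreserving_swap (μ := (volume : Measure (Rn n)))
    (ν := (volume : Measure (Rn n)))).measure_preimage
    (measurableSet_mul_gauge_rpow_le_abs_fst hK hf _ _).nullMeasurableSet

/-- The upper Marcinkiewicz bound for `L^p` functions. -/
lemma ofReal_rpow_mul_volume_superlevelSet_le_lintegral (hn : 1 ≤ n) (hK : IsSymmConvexBody K)
    (hp : 1 ≤ p) (hf : Measurable f) {t : ℝ} (ht : 0 < t) :
    ENNReal.ofReal (t ^ p) * volume (superlevelSet K (n / p) f t)
      ≤ ENNReal.ofReal (2 ^ (p + 1)) * volume K * ∫⁻ x, ‖f x‖ₑ ^ p := by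
  have ht2 : 0 < t / 2 := by positivity
  -- One of `|f x|`, `|f y|` must reach half the required size. Halving the level costs `2 ^ p`, and
  -- having two sets costs another `2`.
  have hsub : superlevelSet K (n / p) f t ⊆
      {z : Rn n × Rn n | t / 2 * gauge K (z.1 - z.2) ^ ((n : ℝ) / p) ≤ |f z.1|} ∪
      {z : Rn n × Rn n | t / 2 * gauge K (z.1 - z.2) ^ ((n : ℝ) / p) ≤ |f z.2|} := by
    intro z hz
    rw [mem_superlevelSet_iff hK] at hz
    by_contra hcon
    simp only [Set.mem_union, Set.mem_ofPred_eq, not_or, not_le] at hcon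
    have := abs_sub (f z.1) (f z.2)
    linarith [hz.2, hcon.1, hcon.2]
  calc
    _ ≤ ENNReal.ofReal (t ^ p) *
      (volume {z : Rn n × Rn n | t / 2 * gauge K (z.1 - z.2) ^ ((n : ℝ) / p) ≤ |f z.1|} +
        volume {z : Rn n × Rn n | t / 2 * gauge K (z.1 - z.2) ^ ((n : ℝ) / p) ≤ |f z.2|}) :=
      mul_le_mul_right ((measure_mono hsub).trans (measure_union_le _ _)) _
    _ = ENNReal.ofReal (2 ^ p) * (volume K * (∫⁻ x, ‖f x‖ₑ ^ p) +
          volume K * ∫⁻ x, ‖f x‖ₑ ^ p) := by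
      have e1 := ofReal_rpow_mul_volume_le_abs_fst hn hK hp hf ht2
      have e2 := ofReal_rpow_mul_volume_le_abs_snd hn hK hp hf ht2
      conv_rhs => congr; rfl; congr; rw [← e1]; rfl; rw [← e2]
      rw [← mul_add, ← mul_assoc, ← ENNReal.ofReal_mul (by positivity),
        ← Real.mul_rpow (by norm_num) ht2.le, mul_div_cancel₀ _ (two_ne_zero)]
    _ = _ := by
      rw [Real.rpow_add_one (by norm_num), ENNReal.ofReal_mul (by positivity),
        ENNReal.ofReal_ofNat]
      ring

/-- Outside `A × A` one of the two values of `g` is zero, so the difference reduces to the other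
value. The term `A × A` is an error independent of `t`. -/
lemma volume_superlevelSet_le_of_support_subset (hK : IsSymmConvexBody K) {A : Set (Rn n)}
    (hA : ∀ x ∉ A, g x = 0) (s t : ℝ) :
    volume (superlevelSet K s g t) ≤
      volume {z : Rn n × Rn n | t * gauge K (z.1 - z.2) ^ s ≤ |g z.1|} +
      volume {z : Rn n × Rn n | t * gauge K (z.1 - z.2) ^ s ≤ |g z.2|} + volume (A ×ˢ A) := by
  refine (measure_mono ?_).trans ((measure_union_le _ _).trans
    (add_le_add_left (measure_union_le _ _) _))
  intro z hz
  rw [mem_superlevelSet_iff hK] at hz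
  simp only [Set.mem_union, Set.mem_ofPred_eq, Set.mem_prod]
  by_cases h1 : z.1 ∈ A
  · by_cases h2 : z.2 ∈ A
    · exact Or.inr ⟨h1, h2⟩
    · rw [hA _ h2, sub_zero] at hz
      exact Or.inl (Or.inl hz.2)
  · rw [hA _ h1, zero_sub, abs_neg] at hz
    exact Or.inl (Or.inr hz.2)

/-- Off the diagonal and off `A × A`, the first set lies in `A × Aᶜ` and the second avoids it, so
they occupy disjoint parts of the superlevel set. Each may also meet `A × A`, whence the factor `2`.
-/
lemma le_volume_superlevelSet_of_support_subset (hn : 1 ≤ n) (hK : IsSymmConvexBody K)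
    {A : Set (Rn n)} (hAm : MeasurableSet A) (hA : ∀ x ∉ A, g x = 0) (hg : Measurable g)
    (s : ℝ) {t : ℝ} (ht : 0 < t) :
    volume {z : Rn n × Rn n | t * gauge K (z.1 - z.2) ^ s ≤ |g z.1|} +
      volume {z : Rn n × Rn n | t * gauge K (z.1 - z.2) ^ s ≤ |g z.2|} ≤
    volume (superlevelSet K s g t) + 2 * volume (A ×ˢ A) := by
  set E := superlevelSet K s g t with hE
  have hEm : MeasurableSet E := measurableSet_superlevelSet hK s hg t
  set D := {z : Rn n × Rn n | z.1 = z.2} with hD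
  have hD0 : volume D = 0 := volume_setOf_fst_eq_snd hn
  have hpos : ∀ z : Rn n × Rn n, z ∉ D → t * gauge K (z.1 - z.2) ^ s ≤ |(0 : ℝ)| → False := by
    intro z hz h
    have := hK.gauge_pos (sub_ne_zero.2 hz)
    have h2 : 0 < t * gauge K (z.1 - z.2) ^ s := by positivity
    rw [abs_zero] at h
    linarith
  have h1 : {z : Rn n × Rn n | t * gauge K (z.1 - z.2) ^ s ≤ |g z.1|}
      ⊆ (E ∩ A ×ˢ Aᶜ ∪ A ×ˢ A) ∪ D := by
    intro z hz
    by_cases hzD : z ∈ D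
    · exact Or.inr hzD
    left
    by_cases hz1 : z.1 ∈ A
    swap
    · rw [Set.mem_ofPred_eq, hA _ hz1] at hz
      exact (hpos z hzD hz).elim
    by_cases hz2 : z.2 ∈ A
    · exact Or.inr ⟨hz1, hz2⟩
    · refine Or.inl ⟨?_, hz1, hz2⟩
      rw [hE, mem_superlevelSet_iff hK, hA _ hz2, sub_zero]
      exact ⟨hzD, hz⟩
  have h2 : {z : Rn n × Rn n | t * gauge K (z.1 - z.2) ^ s ≤ |g z.2|}
      ⊆ (E \ A ×ˢ Aᶜ ∪ A ×ˢ A) ∪ D := by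
    intro z hz
    by_cases hzD : z ∈ D
    · exact Or.inr hzD
    left
    by_cases hz2 : z.2 ∈ A
    swap
    · rw [Set.mem_ofPred_eq, hA _ hz2] at hz
      exact (hpos z hzD hz).elim
    by_cases hz1 : z.1 ∈ A
    · exact Or.inr ⟨hz1, hz2⟩
    · refine Or.inl ⟨?_, fun h => hz1 h.1⟩
      rw [hE, mem_superlevelSet_iff hK, hA _ hz1, zero_sub, abs_neg]
      exact ⟨hzD, hz⟩
  have hb : ∀ B C S : Set (Rn n × Rn n), S ⊆ (B ∪ C) ∪ D → volume S ≤ volume B + volume C := by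
    intro B C S hS
    refine (measure_mono hS).trans ((measure_union_le _ _).trans ?_)
    rw [hD0, add_zero]
    exact measure_union_le _ _
  calc
    _ ≤ (volume (E ∩ A ×ˢ Aᶜ) + volume (A ×ˢ A)) + (volume (E \ A ×ˢ Aᶜ) + volume (A ×ˢ A)) :=
      add_le_add (hb _ _ _ h1) (hb _ _ _ h2)
    _ = (volume (E ∩ A ×ˢ Aᶜ) + volume (E \ A ×ˢ Aᶜ)) + 2 * volume (A ×ˢ A) := by ring
    _ = _ := by rw [measure_inter_add_sdiff _ (hAm.prod hAm.compl)]

lemma tendsto_ofReal_rpow_nhdsGT_zero (hp : 0 < p) :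
    Tendsto (fun t : ℝ => ENNReal.ofReal (t ^ p)) (𝓝[>] 0) (𝓝 0) := by
  have h1 : ContinuousAt (fun t : ℝ => t ^ p) 0 :=
    Real.continuousAt_rpow_const _ _ (Or.inr hp.le)
  have h2 := (ENNReal.continuous_ofReal.tendsto _).comp h1.tendsto
  simp only [Real.zero_rpow hp.ne', ENNReal.ofReal_zero] at h2
  exact h2.mono_left nhdsWithin_le_nhds

/-- The limit formula for functions vanishing outside a set of finite measure. -/
lemma tendsto_of_support_subset (hn : 1 ≤ n) (hK : IsSymmConvexBody K) (hp : 1 ≤ p)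
    {A : Set (Rn n)} (hAm : MeasurableSet A) (hAfin : volume A ≠ ⊤) (hA : ∀ x ∉ A, g x = 0)
    (hg : Measurable g) :
    Tendsto (fun t : ℝ => ENNReal.ofReal (t ^ p) * volume (superlevelSet K (n / p) g t))
      (𝓝[>] 0) (𝓝 (2 * volume K * ∫⁻ x, ‖g x‖ₑ ^ p)) := by
  have hp' : 0 < p := by linarith
  set I := 2 * volume K * ∫⁻ x, ‖g x‖ₑ ^ p with hI
  have hAA : volume (A ×ˢ A) ≠ ⊤ := by
    rw [Measure.volume_eq_prod, Measure.prod_prod]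
    exact ENNReal.mul_ne_top hAfin hAfin
  have hsum : ∀ t : ℝ, 0 < t → ENNReal.ofReal (t ^ p) *
      (volume {z : Rn n × Rn n | t * gauge K (z.1 - z.2) ^ ((n : ℝ) / p) ≤ |g z.1|} +
      volume {z : Rn n × Rn n | t * gauge K (z.1 - z.2) ^ ((n : ℝ) / p) ≤ |g z.2|}) = I := by
    intro t ht
    rw [mul_add, ofReal_rpow_mul_volume_le_abs_fst hn hK hp hg ht,
      ofReal_rpow_mul_volume_le_abs_snd hn hK hp hg ht, hI]
    ring
  have herr : ∀ c : ℝ≥0∞, c ≠ ⊤ → Tendsto (fun t : ℝ => ENNReal.ofReal (t ^ p) * c)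
      (𝓝[>] 0) (𝓝 0) := fun c hc => by
    simpa using ENNReal.Tendsto.mul_const (tendsto_ofReal_rpow_nhdsGT_zero hp') (Or.inr hc)
  have hlo : Tendsto (fun t : ℝ => I - ENNReal.ofReal (t ^ p) * (2 * volume (A ×ˢ A)))
      (𝓝[>] 0) (𝓝 I) := by
    simpa using ENNReal.Tendsto.sub (tendsto_const_nhds (x := I))
      (herr _ (ENNReal.mul_ne_top (by simp) hAA)) (Or.inr ENNReal.zero_ne_top)
  have hup : Tendsto (fun t : ℝ => I + ENNReal.ofReal (t ^ p) * volume (A ×ˢ A))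
      (𝓝[>] 0) (𝓝 I) := by
    simpa using (tendsto_const_nhds (x := I)).add (herr _ hAA)
  refine tendsto_of_tendsto_of_tendsto_of_le_of_le' hlo hup ?_ ?_
  · filter_upwards [self_mem_nhdsWithin] with t ht
    rw [tsub_le_iff_right, ← mul_add, ← hsum t ht]
    exact mul_le_mul_right (le_volume_superlevelSet_of_support_subset hn hK hAm hA hg _ ht) _
  · filter_upwards [self_mem_nhdsWithin] with t ht
    rw [← hsum t ht, ← mul_add]
    exact mul_le_mul_right (volume_superlevelSet_le_of_support_subset hK hA _ _) _

/-- Quasi-subadditivity of the rescaled measures of superlevel sets. -/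
lemma ofReal_rpow_mul_volume_superlevelSet_add_le (hn : 1 ≤ n) (hK : IsSymmConvexBody K)
    (hp : 1 ≤ p) (hh : Measurable h) (hfgh : ∀ x, f x = g x + h x) {δ t : ℝ} (hδ : 0 < δ)
    (ht : 0 < t) :
    ENNReal.ofReal (((1 + δ) * t) ^ p) * volume (superlevelSet K (n / p) f ((1 + δ) * t))
      ≤ ENNReal.ofReal ((1 + δ) ^ p) *
          (ENNReal.ofReal (t ^ p) * volume (superlevelSet K (n / p) g t)) +
        ENNReal.ofReal (((1 + δ) / δ) ^ p) *
          (ENNReal.ofReal (2 ^ (p + 1)) * volume K * ∫⁻ x, ‖h x‖ₑ ^ p) := by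
  have hsub : superlevelSet K (n / p) f ((1 + δ) * t) ⊆
      superlevelSet K (n / p) g t ∪ superlevelSet K (n / p) h (δ * t) := by
    intro z hz
    simp only [Set.mem_union, mem_superlevelSet_iff hK] at hz ⊢
    by_contra! hcon
    have h1 := hcon.1 hz.1
    have h2 := hcon.2 hz.1
    have h3 : f z.1 - f z.2 = (g z.1 - g z.2) + (h z.1 - h z.2) := by rw [hfgh, hfgh]; ring
    have h4 := abs_add_le (g z.1 - g z.2) (h z.1 - h z.2)
    rw [← h3] at h4
    have := hz.2
    linarith
  refine (mul_le_mul_right ((measure_mono hsub).trans (measure_union_le _ _)) _).trans ?_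
  rw [mul_add]
  refine add_le_add (le_of_eq ?_) ?_
  · rw [Real.mul_rpow (by positivity) ht.le, ENNReal.ofReal_mul (by positivity), mul_assoc]
  · refine le_trans (le_of_eq ?_) (mul_le_mul_right
      (ofReal_rpow_mul_volume_superlevelSet_le_lintegral hn hK hp hh (mul_pos hδ ht)) _)
    rw [← mul_assoc, ← ENNReal.ofReal_mul (by positivity), ← Real.mul_rpow (by positivity)
      (by positivity)]
    rw [show (1 + δ) / δ * (δ * t) = (1 + δ) * t by field_simp]

end LebesgueFunctions

/-! ### The limit for general `L^p` functions as the level tends to zero. -/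

section LebesgueLimit

variable {n : ℕ} {K : Set (Rn n)} {f g h : Rn n → ℝ} {p : ℝ}

lemma tendsto_mul_nhdsGT_zero {c : ℝ} (hc : 0 < c) :
    Tendsto (fun t : ℝ => c * t) (𝓝[>] 0) (𝓝[>] 0) := by
  refine tendsto_nhdsWithin_iff.2 ⟨?_, ?_⟩
  · have : Tendsto (fun t : ℝ => c * t) (𝓝 0) (𝓝 (c * 0)) :=
      (continuous_const_mul c).tendsto 0
    rw [mul_zero] at this
    exact this.mono_left nhdsWithin_le_nhds
  · filter_upwards [self_mem_nhdsWithin] with t ht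
    exact mul_pos hc ht

/-- Truncation at height `1 / (k + 1)`: the small part tends to zero and the large part tends to
the whole in `L^p`. -/
lemma tendsto_lintegral_truncation (hp : 0 < p) (hf : Measurable f)
    (hfin : ∫⁻ x, ‖f x‖ₑ ^ p ≠ ⊤) :
    Tendsto (fun k : ℕ => ∫⁻ x, ‖{x | 1 / ((k : ℝ) + 1) ≤ |f x|}.indicator f x‖ₑ ^ p) atTop
      (𝓝 (∫⁻ x, ‖f x‖ₑ ^ p)) ∧
    Tendsto (fun k : ℕ => ∫⁻ x, ‖{x | 1 / ((k : ℝ) + 1) ≤ |f x|}ᶜ.indicator f x‖ₑ ^ p) atTop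
      (𝓝 0) := by
  have hAm : ∀ k : ℕ, MeasurableSet {x | 1 / ((k : ℝ) + 1) ≤ |f x|} := fun k =>
    measurableSet_le measurable_const (by fun_prop)
  have hev : ∀ x, f x ≠ 0 → ∀ᶠ k : ℕ in atTop, x ∈ {x | 1 / ((k : ℝ) + 1) ≤ |f x|} := by
    intro x hx
    filter_upwards [(tendsto_one_div_add_atTop_nhds_zero_nat (𝕜 := ℝ)).eventually_lt_const
      (abs_pos.2 hx)] with k hk
    exact hk.le
  have hle : ∀ (A : Set (Rn n)) x, ‖A.indicator f x‖ₑ ^ p ≤ ‖f x‖ₑ ^ p := fun A x => by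
    refine ENNReal.rpow_le_rpow ?_ hp.le
    by_cases hx : x ∈ A <;> simp [hx]
  constructor
  · refine tendsto_lintegral_of_dominated_convergence (fun x => ‖f x‖ₑ ^ p)
      (fun k => ((hf.indicator (hAm k)).enorm.pow_const p)) (fun k => ae_of_all _ (hle _)) hfin
      (ae_of_all _ fun x => ?_)
    by_cases hx : f x = 0
    · refine tendsto_const_nhds.congr fun k => ?_
      by_cases hxA : x ∈ {x | 1 / ((k : ℝ) + 1) ≤ |f x|} <;> simp [Set.indicator, hx]
    · refine tendsto_const_nhds.congr' ?_
      filter_upwards [hev x hx] with k hk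
      rw [Set.indicator_of_mem (show x ∈ {x | 1 / ((k : ℝ) + 1) ≤ |f x|} from hk)]
  · have h0 : ∫⁻ _ : Rn n, (0 : ℝ≥0∞) = 0 := lintegral_zero
    rw [← h0]
    refine tendsto_lintegral_of_dominated_convergence (fun x => ‖f x‖ₑ ^ p)
      (fun k => ((hf.indicator (hAm k).compl).enorm.pow_const p))
      (fun k => ae_of_all _ (hle _)) hfin (ae_of_all _ fun x => ?_)
    refine tendsto_const_nhds.congr' ?_
    by_cases hx : f x = 0
    · filter_upwards with k
      simp [Set.indicator, hx, hp]
    · filter_upwards [hev x hx] with k hk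
      rw [Set.indicator_of_notMem
        (show x ∉ {x | 1 / ((k : ℝ) + 1) ≤ |f x|}ᶜ from fun h => h hk)]
      simp [hp]

/-- Chebyshev's inequality; it puts the truncated function in the scope of
`tendsto_of_support_subset`. -/
lemma volume_one_div_le_abs_lt_top (hp : 0 < p) (hf : Measurable f)
    (hfin : ∫⁻ x, ‖f x‖ₑ ^ p ≠ ⊤) (k : ℕ) :
    volume {x | 1 / ((k : ℝ) + 1) ≤ |f x|} ≠ ⊤ := by
  have hk : (0 : ℝ) < 1 / ((k : ℝ) + 1) := by positivity
  have h1 := meas_ge_le_lintegral_div (μ := (volume : Measure (Rn n)))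
    (f := fun x => ‖f x‖ₑ ^ p) (hf.enorm.pow_const p).aemeasurable
    (ε := ENNReal.ofReal ((1 / ((k : ℝ) + 1)) ^ p)) (by simpa using Real.rpow_pos_of_pos hk p)
    ENNReal.ofReal_ne_top
  refine ne_top_of_le_ne_top (ENNReal.div_ne_top hfin ?_) ((measure_mono ?_).trans h1)
  · simpa using Real.rpow_pos_of_pos hk p
  · intro x hx
    simp only [Set.mem_ofPred_eq] at hx ⊢
    rw [Real.enorm_eq_ofReal_abs, ENNReal.ofReal_rpow_of_nonneg (abs_nonneg _) hp.le]
    exact ENNReal.ofReal_le_ofReal (Real.rpow_le_rpow hk.le hx hp.le)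

lemma tendsto_ofReal_one_add_rpow (p : ℝ) :
    Tendsto (fun δ : ℝ => ENNReal.ofReal ((1 + δ) ^ p)) (𝓝[>] 0) (𝓝 1) := by
  have h1 : ContinuousAt (fun δ : ℝ => (1 + δ) ^ p) 0 := by
    refine ContinuousAt.rpow_const (by fun_prop) (Or.inl (by norm_num))
  have h2 := (ENNReal.continuous_ofReal.tendsto _).comp h1.tendsto
  simp only [add_zero, Real.one_rpow, ENNReal.ofReal_one] at h2
  exact h2.mono_left nhdsWithin_le_nhds

/-- The limit formula for measurable functions with `∫ |f| ^ p < ∞`. -/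
lemma tendsto_rpow_mul_volume_superlevelSet_of_lintegral_ne_top (hn : 1 ≤ n)
    (hK : IsSymmConvexBody K) (hp : 1 ≤ p) (hf : Measurable f) (hfin : ∫⁻ x, ‖f x‖ₑ ^ p ≠ ⊤) :
    Tendsto (fun t : ℝ => ENNReal.ofReal (t ^ p) * volume (superlevelSet K (n / p) f t))
      (𝓝[>] 0) (𝓝 (2 * volume K * ∫⁻ x, ‖f x‖ₑ ^ p)) := by
  have hp' : 0 < p := by linarith
  set A : ℕ → Set (Rn n) := fun k => {x | 1 / ((k : ℝ) + 1) ≤ |f x|} with hA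
  have hAm : ∀ k, MeasurableSet (A k) := fun k => measurableSet_le measurable_const (by fun_prop)
  set g : ℕ → Rn n → ℝ := fun k => (A k).indicator f with hg
  set h : ℕ → Rn n → ℝ := fun k => (A k)ᶜ.indicator f with hh
  have hgm : ∀ k, Measurable (g k) := fun k => hf.indicator (hAm k)
  have hhm : ∀ k, Measurable (h k) := fun k => hf.indicator (hAm k).compl
  have hfgh : ∀ k x, f x = g k x + h k x := fun k x =>
    (congrFun (Set.indicator_self_add_compl (A k) f) x).symm
  obtain ⟨hglim, hhlim⟩ := tendsto_lintegral_truncation hp' hf hfin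
  have hΦg : ∀ k, Tendsto
      (fun t : ℝ => ENNReal.ofReal (t ^ p) * volume (superlevelSet K (n / p) (g k) t))
      (𝓝[>] 0) (𝓝 (2 * volume K * ∫⁻ x, ‖g k x‖ₑ ^ p)) := fun k =>
    tendsto_of_support_subset hn hK hp (hAm k) (volume_one_div_le_abs_lt_top hp' hf hfin k)
      (fun x hx => Set.indicator_of_notMem hx _) (hgm k)
  set V := 2 * volume K with hV
  have hVtop : V ≠ ⊤ := ENNReal.mul_ne_top (by simp) hK.volume_lt_top.ne
  set C := ENNReal.ofReal (2 ^ (p + 1)) * volume K with hC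
  have hCtop : C ≠ ⊤ := ENNReal.mul_ne_top ENNReal.ofReal_ne_top hK.volume_lt_top.ne
  set I := ∫⁻ x, ‖f x‖ₑ ^ p with hI
  have hVg : Tendsto (fun k => V * ∫⁻ x, ‖g k x‖ₑ ^ p) atTop (𝓝 (V * I)) :=
    ENNReal.Tendsto.const_mul hglim (Or.inr hVtop)
  have herr : ∀ c : ℝ, Tendsto (fun k => ENNReal.ofReal c * (C * ∫⁻ x, ‖h k x‖ₑ ^ p)) atTop
      (𝓝 0) := fun c => by
    have := ENNReal.Tendsto.const_mul (a := ENNReal.ofReal c)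
      (ENNReal.Tendsto.const_mul (a := C) hhlim (Or.inr hCtop)) (Or.inr ENNReal.ofReal_ne_top)
    rwa [mul_zero, mul_zero] at this
  set Φ : ℝ → ℝ≥0∞ := fun t => ENNReal.ofReal (t ^ p) * volume (superlevelSet K (n / p) f t)
    with hΦ
  refine tendsto_of_le_liminf_of_limsup_le ?_ ?_
  -- Lower bound: quasi-subadditivity is applied to `g k = f + (-h k)`. The order is `t → 0`, then
  -- `k → ∞`, then `δ → 0`, because the factor `((1 + δ) / δ) ^ p` of the remainder blows up in `δ`.
  · have hδ : ∀ δ : ℝ, 0 < δ → V * I ≤ ENNReal.ofReal ((1 + δ) ^ p) * liminf Φ (𝓝[>] 0) := by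
      intro δ hδ
      have h1δ : 0 < 1 + δ := by linarith
      have ha0 : ENNReal.ofReal ((1 + δ) ^ p) ≠ 0 := by
        simpa using Real.rpow_pos_of_pos h1δ p
      have hk : ∀ k, V * (∫⁻ x, ‖g k x‖ₑ ^ p) ≤ ENNReal.ofReal ((1 + δ) ^ p) * liminf Φ (𝓝[>] 0)
          + ENNReal.ofReal (((1 + δ) / δ) ^ p) * (C * ∫⁻ x, ‖h k x‖ₑ ^ p) := by
        intro k
        set b := ENNReal.ofReal (((1 + δ) / δ) ^ p) * (C * ∫⁻ x, ‖h k x‖ₑ ^ p) with hb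
        have ht : ∀ᶠ t in 𝓝[>] (0 : ℝ), (ENNReal.ofReal ((1 + δ) ^ p))⁻¹ *
            (ENNReal.ofReal (((1 + δ) * t) ^ p) *
              volume (superlevelSet K (n / p) (g k) ((1 + δ) * t)) - b) ≤ Φ t := by
          filter_upwards [self_mem_nhdsWithin] with t ht
          have key := ofReal_rpow_mul_volume_superlevelSet_add_le (f := g k) (g := f)
            (h := fun x => -h k x) hn hK hp (hhm k).neg
            (fun x => by rw [hfgh k x]; ring) hδ ht
          simp only [enorm_neg] at key
          rw [ENNReal.inv_mul_le_iff ha0 ENNReal.ofReal_ne_top, tsub_le_iff_right]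
          exact key
        have hbtop : b ≠ ⊤ := by
          refine ENNReal.mul_ne_top ENNReal.ofReal_ne_top (ENNReal.mul_ne_top hCtop ?_)
          refine ne_top_of_le_ne_top hfin (lintegral_mono fun x => ENNReal.rpow_le_rpow ?_ hp'.le)
          by_cases hx : x ∈ (A k)ᶜ <;> simp [hh, hx]
        have hlim := ENNReal.Tendsto.const_mul (a := (ENNReal.ofReal ((1 + δ) ^ p))⁻¹)
          (ENNReal.Tendsto.sub ((hΦg k).comp (tendsto_mul_nhdsGT_zero h1δ))
            (tendsto_const_nhds (x := b)) (Or.inr hbtop)) (Or.inr (ENNReal.inv_ne_top.2 ha0))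
        have h2 := hlim.liminf_eq.symm.le.trans (liminf_le_liminf ht)
        rwa [ENNReal.inv_mul_le_iff ha0 ENNReal.ofReal_ne_top, tsub_le_iff_right] at h2
      refine le_of_tendsto_of_tendsto' hVg ?_ hk
      simpa using (tendsto_const_nhds (x := ENNReal.ofReal ((1 + δ) ^ p) * liminf Φ (𝓝[>] 0))).add
        (herr (((1 + δ) / δ) ^ p))
    -- The limiting factor `1` is nonzero, so the `liminf` need not be known to be finite.
    have h1 := ENNReal.Tendsto.mul_const (b := liminf Φ (𝓝[>] 0)) (tendsto_ofReal_one_add_rpow p)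
      (Or.inl one_ne_zero)
    rw [one_mul] at h1
    exact ge_of_tendsto h1 (by filter_upwards [self_mem_nhdsWithin] with δ h using hδ δ h)
  -- Upper bound: the same scheme for `f = g k + h k`, with the level written as `(1 + δ) · ((1 +
  -- δ)⁻¹ t)`.
  · have hδ : ∀ δ : ℝ, 0 < δ → limsup Φ (𝓝[>] 0) ≤ ENNReal.ofReal ((1 + δ) ^ p) * (V * I) := by
      intro δ hδ
      have h1δ : 0 < 1 + δ := by linarith
      have hk : ∀ k, limsup Φ (𝓝[>] 0) ≤
          ENNReal.ofReal ((1 + δ) ^ p) * (V * ∫⁻ x, ‖g k x‖ₑ ^ p)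
          + ENNReal.ofReal (((1 + δ) / δ) ^ p) * (C * ∫⁻ x, ‖h k x‖ₑ ^ p) := by
        intro k
        set b := ENNReal.ofReal (((1 + δ) / δ) ^ p) * (C * ∫⁻ x, ‖h k x‖ₑ ^ p) with hb
        have ht : ∀ᶠ t in 𝓝[>] (0 : ℝ), Φ t ≤ ENNReal.ofReal ((1 + δ) ^ p) *
            (ENNReal.ofReal (((1 + δ)⁻¹ * t) ^ p) *
              volume (superlevelSet K (n / p) (g k) ((1 + δ)⁻¹ * t))) + b := by
          filter_upwards [self_mem_nhdsWithin] with t ht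
          have key := ofReal_rpow_mul_volume_superlevelSet_add_le hn hK hp (hhm k) (hfgh k) hδ
            (mul_pos (inv_pos.2 h1δ) ht)
          rwa [mul_inv_cancel_left₀ h1δ.ne'] at key
        have hlim := (ENNReal.Tendsto.const_mul (a := ENNReal.ofReal ((1 + δ) ^ p))
          ((hΦg k).comp (tendsto_mul_nhdsGT_zero (inv_pos.2 h1δ)))
          (Or.inr ENNReal.ofReal_ne_top)).add (tendsto_const_nhds (x := b))
        exact (limsup_le_limsup ht).trans hlim.limsup_eq.le
      have h2 := (ENNReal.Tendsto.const_mul (a := ENNReal.ofReal ((1 + δ) ^ p)) hVg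
        (Or.inr ENNReal.ofReal_ne_top)).add (herr (((1 + δ) / δ) ^ p))
      rw [add_zero] at h2
      exact ge_of_tendsto' h2 hk
    have h1 := ENNReal.Tendsto.mul_const (b := V * I) (tendsto_ofReal_one_add_rpow p)
      (Or.inl one_ne_zero)
    rw [one_mul] at h1
    exact ge_of_tendsto h1 (by filter_upwards [self_mem_nhdsWithin] with δ h using hδ δ h)

/-- Both projections pull null sets back to null sets. This allows replacing an `L^p` function by a
measurable representative. -/
lemma volume_superlevelSet_congr (hfg : f =ᵐ[volume] g) (s t : ℝ) :
    volume (superlevelSet K s f t) = volume (superlevelSet K s g t) := by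
  refine measure_congr ?_
  rw [Measure.volume_eq_prod]
  filter_upwards [Measure.quasiMeasurePreserving_fst.ae hfg,
    Measure.quasiMeasurePreserving_snd.ae hfg] with z h1 h2
  change (z ∈ superlevelSet K s f t) = (z ∈ superlevelSet K s g t)
  simp only [superlevelSet, Set.mem_ofPred_eq, h1, h2]

lemma eLpNorm_ofReal_rpow (hp : 0 < p) :
    eLpNorm f (ENNReal.ofReal p) volume ^ p = ∫⁻ x, ‖f x‖ₑ ^ p := by
  rw [eLpNorm_eq_lintegral_rpow_enorm_toReal (by simpa using hp) ENNReal.ofReal_ne_top,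
    ENNReal.toReal_ofReal hp.le, ← ENNReal.rpow_mul, one_div_mul_cancel hp.ne', ENNReal.rpow_one]

end LebesgueLimit

/-! ### Assembly of both parts. -/

theorem theorem1 (n : ℕ) (hn : 1 ≤ n) :
    (∃ C : ℝ≥0, 0 < C ∧ ∀ (p : ℝ), 1 ≤ p → ∀ (K : Set (Rn n)), IsSymmConvexBody K →
      ∀ f : Rn n → ℝ, ContDiff ℝ ∞ f → HasCompactSupport f →
        (2 / (n : ℝ≥0∞)) * anisotropicEnergy K p f
            ≤ weakLpQuasinormPow p (anisotropicQuotient K (n / p + 1) f) ∧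
        weakLpQuasinormPow p (anisotropicQuotient K (n / p + 1) f)
            ≤ (C : ℝ≥0∞) * anisotropicEnergy K p f ∧
        Tendsto (fun t : ℝ =>
            ENNReal.ofReal (t ^ p) * volume (superlevelSet K (n / p + 1) f t))
          atTop (𝓝 ((2 / (n : ℝ≥0∞)) * anisotropicEnergy K p f))) ∧
    (∀ (p : ℝ), 1 ≤ p → ∀ (K : Set (Rn n)), IsSymmConvexBody K →
      ∀ f : Rn n → ℝ, MemLp f (ENNReal.ofReal p) volume →
        2 * volume K * eLpNorm f (ENNReal.ofReal p) volume ^ p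
            ≤ weakLpQuasinormPow p (anisotropicQuotient K (n / p) f) ∧
        weakLpQuasinormPow p (anisotropicQuotient K (n / p) f)
            ≤ ENNReal.ofReal (2 ^ (p + 1)) * volume K *
              eLpNorm f (ENNReal.ofReal p) volume ^ p ∧
        Tendsto (fun t : ℝ =>
            ENNReal.ofReal (t ^ p) * volume (superlevelSet K (n / p) f t))
          (𝓝[>] 0) (𝓝 (2 * volume K * eLpNorm f (ENNReal.ofReal p) volume ^ p))) := by
  constructor
  -- The covering along lines gives `2 · 5 ^ (n+1)`; the other `2` comes from the spherical formula,
  -- which represents twice the polar moment norm.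
  · refine ⟨4 * 5 ^ (n + 1), by positivity, fun p hp K hK f hf hc => ?_⟩
    have hf1 : ContDiff ℝ 1 f := hf.of_le (by exact_mod_cast le_top)
    have hlim := tendsto_rpow_mul_volume_superlevelSet hn hK hf1 hc hp
    obtain ⟨M, hM⟩ := hc.exists_bound_of_continuous hf1.continuous
    rw [weakLpQuasinormPow_eq_iSup_superlevelSet]
    refine ⟨le_of_tendsto hlim ?_, iSup₂_le fun t ht => ?_, hlim⟩
    · filter_upwards [eventually_gt_atTop 0] with t ht
      exact le_iSup₂ (f := fun (t : ℝ) (_ : 0 < t) =>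
        ENNReal.ofReal (t ^ p) * volume (superlevelSet K (n / p + 1) f t)) t ht
    · have h := ofReal_rpow_mul_volume_superlevelSet_le hn hK hf1 hM hp ht
      have hC : ((4 * 5 ^ (n + 1) : ℝ≥0) : ℝ≥0∞) = 4 * ENNReal.ofReal (5 ^ (n + 1)) := by
        rw [ENNReal.ofReal_pow (by norm_num)]
        simp
      rw [hC]
      exact h
  · intro p hp K hK f hf
    have hp' : 0 < p := by linarith
    have hgm : Measurable (hf.1.mk f) := hf.1.stronglyMeasurable_mk.measurable
    have hfg := hf.1.ae_eq_mk
    rw [weakLpQuasinormPow_eq_iSup_superlevelSet, eLpNorm_congr_ae hfg, eLpNorm_ofReal_rpow hp']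
    simp only [volume_superlevelSet_congr hfg]
    have hfin : ∫⁻ x, ‖hf.1.mk f x‖ₑ ^ p ≠ ⊤ := by
      rw [← eLpNorm_ofReal_rpow hp', ← eLpNorm_congr_ae hfg]
      exact ENNReal.rpow_ne_top_of_nonneg hp'.le hf.2.ne
    have hlim := tendsto_rpow_mul_volume_superlevelSet_of_lintegral_ne_top hn hK hp hgm hfin
    refine ⟨le_of_tendsto hlim ?_, iSup₂_le fun t ht => ?_, hlim⟩
    · filter_upwards [self_mem_nhdsWithin] with t ht
      exact le_iSup₂ (f := fun (t : ℝ) (_ : 0 < t) =>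
        ENNReal.ofReal (t ^ p) * volume (superlevelSet K (n / p) (hf.1.mk f) t)) t ht
    · exact ofReal_rpow_mul_volume_superlevelSet_le_lintegral hn hK hp hgm ht
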